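/- Let $q$ be a formal variable and, for $k\ge 0$, $(a;q)_k=\prod_{i=0}^{k-1}(1-aq^i)$. For partitions $\mu,\lambda$ write $\mu\prec\lambda$ if $\mu\subseteq\lambda$ and $\lambda/\mu$ has at most one box in each column. The one-variable skew inhomogeneous $q$-Whittaker polynomial is $$\mathbb F_{\lambda/\mu}(x)=\mathbf 1_{\mu\prec\lambda}\;x^{|\lambda|-|\mu|}\prod_{r=1}^{\ell(\lambda)}(x;q)_{\mu_r-\lambda_{r+1}}\,\frac{(q;q)_{\lambda_r-\lambda_{r+1}}}{(q;q)_{\lambda_r-\mu_r}\,(q;q)_{\mu_r-\lambda_{r+1}}},$$ and the $n$-variable ones are defined by $\mathbb F_{\lambda/\mu}(x_1,\dots,x_n)=\sum_{\mu\subseteq\nu\prec\lambda}\mathbb F_{\nu/\mu}(x_1,\dots,x_{n-1})\,\mathbb F_{\lambda/\nu}(x_n)$. They are stable under setting $x_n=0$; let $\mathbb F_{\lambda/\mu}$ be the resulting formal power series in $x_1,x_2,\dots$ over $\mathbb R(q)$, and $\mathbb F_\lambda=\mathbb F_{\lambda/\varnothing}$. Let $\hat\Lambda$ be the completion, with respect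 to the degree filtration, of the ring $\Lambda$ of symmetric functions over $\mathbb R(q)$, that is, the ring of symmetric formal power series in $x_1,x_2,\dots$ of possibly unbounded degree. **Theorem 3.1.** (a) For all partitions $\mu,\nu$ there are unique coefficients $c^\lambda_{\mu,\nu}\in\mathbb R(q)$ such that $\mathbb F_\mu\,\mathbb F_\nu=\sum_\lambda c^\lambda_{\mu,\nu}\,\mathbb F_\lambda$ (where infinitely many terms are a priori allowed, the sum being taken coefficientwise in $x_1,x_2,\dots$), and for fixed $\mu,\nu$ only finitely many of the $c^\lambda_{\mu,\nu}$ are non-zero. (b) The functions $\mathbb F_\lambda$, with $\lambda$ ranging over all partitions, lie in $\hat\Lambda$ and form an $\mathbb R(q)$-basis of a commutative $\mathbb R(q)$-subalgebra (in particular, a subring) $\Gamma^q=\bigoplus_\lambda\mathbb R(q)\,\mathbb F_\lambda$ of $\hat\Lambda$. (c) All skew functions $\mathbb F_{\lambda/\mu}$ belong to $\Gamma^q$, and $\Gamma^q$, with its product, is a commutative and cocommutative bialgebra over $\mathbb R(q)$ whose coproduct $\Delta:\Gamma^q\to\Gamma^q\otimes_{\mathbb R(q)}\Gamma^q$ is given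 by $$\Delta(\mathbb F_\lambda)=\sum_{\mu\subseteq\lambda}\mathbb F_{\lambda/\mu}\otimes\mathbb F_\mu$$ and whose counit is the linear map with $\mathbb F_\varnothing\mapsto 1$ and $\mathbb F_\lambda\mapsto 0$ for $\lambda\neq\varnothing$. -/

import Mathlib

open scoped TensorProduct

noncomputable section

namespace InhomQWhittaker

/-- The ground field `ℝ(q)` of rational functions in a formal variable `q`. -/
abbrev K : Type := RatFunc ℝ

/-- The formal parameter `q`. -/
def q : K := RatFunc.X

/-- The `q`-Pochhammer symbol `(a; p)_k = ∏_{i < k} (1 - a p ^ i)`. -/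
def qPoch {R : Type*} [CommRing R] (a p : R) (k : ℕ) : R :=
  ∏ i ∈ Finset.range k, (1 - a * p ^ i)

/-! Partitions are Young diagrams in English notation: `λ.rowLen i` is the part `λ_{i+1}`,
`λ.colLen 0` is the length `ℓ(λ)`, `λ.card` is the size `|λ|`, `≤` is containment and `⊥` is the
empty partition. -/

theorem finite_Iic (lam : YoungDiagram) : (Set.Iic lam).Finite := by
  refine Set.Finite.of_finite_image (f := YoungDiagram.cells) ?_ ?_
  · refine (Finset.finite_toSet lam.cells.powerset).subset ?_
    rintro _ ⟨mu, hmu, rfl⟩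
    simpa using hmu
  · intro a _ b _ h
    exact YoungDiagram.ext h

/-- The finite set of all partitions contained in `lam`. -/
def below (lam : YoungDiagram) : Finset YoungDiagram := (finite_Iic lam).toFinset

theorem mem_below {lam mu : YoungDiagram} : mu ∈ below lam ↔ mu ≤ lam := by
  simp [below]

/-- `mu ≺ lam`: the skew diagram `lam / mu` is a horizontal strip, that is, `mu ⊆ lam` and
`lam / mu` has at most one box in each column. -/
def HorizontalStrip (mu lam : YoungDiagram) : Prop :=
  mu ≤ lam ∧ ∀ i i' j : ℕ, (i, j) ∈ lam.cells \ mu.cells → (i', j) ∈ lam.cells \ mu.cells → i = i'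

open scoped Classical in
/-- The one-variable skew inhomogeneous `q`-Whittaker polynomial `𝔽_{lam/mu}(x)`, as a polynomial
in `x`. The natural-number subtractions are genuine because of the condition `mu ≺ lam`. -/
def oneVar (lam mu : YoungDiagram) : Polynomial K :=
  if HorizontalStrip mu lam then
    Polynomial.X ^ (lam.card - mu.card) *
      ∏ r ∈ Finset.range (lam.colLen 0),
        (qPoch Polynomial.X (Polynomial.C q) (mu.rowLen r - lam.rowLen (r + 1)) *
          Polynomial.C (qPoch q q (lam.rowLen r - lam.rowLen (r + 1)) /
            (qPoch q q (lam.rowLen r - mu.rowLen r) *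
              qPoch q q (mu.rowLen r - lam.rowLen (r + 1)))))
  else 0

open scoped Classical in
/-- The skew inhomogeneous `q`-Whittaker polynomial `𝔽_{lam/mu}(x_0, …, x_{n-1})` in `n` variables,
defined by the branching formula
`𝔽_{lam/mu}(x_0, …, x_n) = ∑_{mu ⊆ nu ≺ lam} 𝔽_{nu/mu}(x_0, …, x_{n-1}) 𝔽_{lam/nu}(x_n)`. -/
def skewPoly : ℕ → YoungDiagram → YoungDiagram → MvPolynomial ℕ K
  | 0, lam, mu => if lam = mu then 1 else 0
  | n + 1, lam, mu =>
      ∑ nu ∈ (below lam).filter (fun nu => mu ≤ nu ∧ HorizontalStrip nu lam),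
        skewPoly n nu mu * Polynomial.aeval (MvPolynomial.X n) (oneVar lam nu)

/-- The skew inhomogeneous `q`-Whittaker function `𝔽_{lam/mu}(x_0, x_1, …)` in infinitely many
variables: the inverse limit of the polynomials `skewPoly n lam mu`. The coefficient of a monomial
is read off in any number of variables that is large enough for the monomial to occur
(see `coeff_skewF`). -/
def skewF (lam mu : YoungDiagram) : MvPowerSeries ℕ K :=
  fun d => MvPolynomial.coeff d (skewPoly (d.support.sup Nat.succ) lam mu)

/-- The inhomogeneous `q`-Whittaker function `𝔽_lam(x_0, x_1, …)`. -/
def F (lam : YoungDiagram) : MvPowerSeries ℕ K := skewF lam ⊥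

/-! ### Stability: `skewF` is the inverse limit of the polynomials `skewPoly n` -/

theorem qPoch_q_ne_zero (k : ℕ) : qPoch q q k ≠ 0 := by
  unfold qPoch
  refine Finset.prod_ne_zero_iff.mpr fun i _ h => ?_
  have h1 : (algebraMap (Polynomial ℝ) K) (1 - Polynomial.X ^ (i + 1)) = 0 := by
    rw [← h]; simp [q, pow_succ, mul_comm]
  rw [map_eq_zero_iff _ (RatFunc.algebraMap_injective ℝ)] at h1
  have h2 := congrArg (Polynomial.eval 0) h1
  simp at h2

theorem coeff_zero_oneVar_self (lam : YoungDiagram) : (oneVar lam lam).coeff 0 = 1 := by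
  have hs : HorizontalStrip lam lam := ⟨le_rfl, by simp⟩
  rw [oneVar, if_pos hs, Polynomial.coeff_zero_eq_eval_zero]
  simp only [Polynomial.eval_mul, Polynomial.eval_prod, Polynomial.eval_pow, Polynomial.eval_X,
    Polynomial.eval_C, Nat.sub_self, pow_zero, one_mul, qPoch, Polynomial.eval_sub,
    Polynomial.eval_one, zero_mul, sub_zero, Finset.prod_const_one, Finset.range_zero,
    Finset.prod_empty]
  exact Finset.prod_eq_one fun r _ => div_self (qPoch_q_ne_zero _)

theorem coeff_zero_oneVar_of_ne {lam mu : YoungDiagram} (h : mu ≠ lam) :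
    (oneVar lam mu).coeff 0 = 0 := by
  unfold oneVar
  split_ifs with hs
  · have hlt : mu.card < lam.card :=
      Finset.card_lt_card (YoungDiagram.cells_ssubset_iff.mpr (lt_of_le_of_ne hs.1 h))
    rw [Polynomial.coeff_zero_eq_eval_zero, Polynomial.eval_mul, Polynomial.eval_pow,
      Polynomial.eval_X, zero_pow (by omega), zero_mul]
  · simp

theorem skewPoly_eq_zero {n : ℕ} {lam mu : YoungDiagram} (h : ¬ mu ≤ lam) :
    skewPoly n lam mu = 0 := by
  classical
  cases n with
  | zero =>
    rw [skewPoly, if_neg]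
    rintro rfl
    exact h le_rfl
  | succ n =>
    rw [skewPoly]
    refine Finset.sum_eq_zero fun nu hnu => ?_
    rw [Finset.mem_filter, mem_below] at hnu
    exact absurd (hnu.2.1.trans hnu.1) h

theorem coeff_mul_aeval_X (p : MvPolynomial ℕ K) (r : Polynomial K) (n : ℕ) (d : ℕ →₀ ℕ)
    (hd : d n = 0) :
    MvPolynomial.coeff d (p * Polynomial.aeval (MvPolynomial.X n) r) =
      MvPolynomial.coeff d p * r.coeff 0 := by
  conv_lhs => rw [← Polynomial.divX_mul_X_add r]
  rw [map_add, map_mul, Polynomial.aeval_X, Polynomial.aeval_C, mul_add, ← mul_assoc,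
    MvPolynomial.coeff_add, MvPolynomial.coeff_mul_X', if_neg (by simp [hd]), zero_add,
    MvPolynomial.algebraMap_eq, mul_comm, MvPolynomial.coeff_C_mul, mul_comm]

theorem coeff_skewPoly_succ (n : ℕ) (lam mu : YoungDiagram) (d : ℕ →₀ ℕ) (hd : d n = 0) :
    MvPolynomial.coeff d (skewPoly (n + 1) lam mu) = MvPolynomial.coeff d (skewPoly n lam mu) := by
  classical
  rw [skewPoly, MvPolynomial.coeff_sum]
  by_cases h : mu ≤ lam
  · rw [Finset.sum_eq_single lam]
    · rw [coeff_mul_aeval_X _ _ _ _ hd, coeff_zero_oneVar_self, mul_one]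
    · intro nu _ hne
      rw [coeff_mul_aeval_X _ _ _ _ hd, coeff_zero_oneVar_of_ne hne, mul_zero]
    · intro hn
      refine absurd ?_ hn
      rw [Finset.mem_filter, mem_below]
      exact ⟨le_rfl, h, le_rfl, by simp⟩
  · rw [skewPoly_eq_zero h, MvPolynomial.coeff_zero]
    refine Finset.sum_eq_zero fun nu hnu => ?_
    rw [Finset.mem_filter, mem_below] at hnu
    exact absurd (hnu.2.1.trans hnu.1) h

/-- In any number `n` of variables that contains the variables of the monomial `d`, the coefficient
of `d` in the `n`-variable polynomial is its coefficient in `skewF lam mu`. -/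
theorem coeff_skewF (lam mu : YoungDiagram) (d : ℕ →₀ ℕ) (n : ℕ) (hd : ∀ i, n ≤ i → d i = 0) :
    MvPowerSeries.coeff d (skewF lam mu) = MvPolynomial.coeff d (skewPoly n lam mu) := by
  have hN : d.support.sup Nat.succ ≤ n := by
    refine Finset.sup_le fun i hi => ?_
    by_contra hlt
    exact (Finsupp.mem_support_iff.mp hi) (hd i (by simp at hlt; omega))
  change MvPolynomial.coeff d (skewPoly (d.support.sup Nat.succ) lam mu) = _
  have key : ∀ i, d.support.sup Nat.succ ≤ i → d i = 0 := by
    intro i hi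
    by_contra hne
    have := Finset.le_sup (f := Nat.succ) (Finsupp.mem_support_iff.mpr hne)
    simp only [Nat.succ_eq_add_one] at this hi
    omega
  generalize d.support.sup Nat.succ = N at hN key
  induction n, hN using Nat.le_induction with
  | base => rfl
  | succ m hm ih =>
    rw [coeff_skewPoly_succ m lam mu d (key m hm)]
    exact ih fun i hi => key i (hm.trans hi)

/-! ### Symmetric functions and their completion -/

/-- The completion `Λ̂` (by the degree filtration) of the ring `Λ` of symmetric functions over
`ℝ(q)`: all formal power series in `x_0, x_1, …`, of possibly unbounded degree, that are invariant
under permutations of the variables (see `mem_LamHat_iff`). -/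
def LamHat : Subalgebra K (MvPowerSeries ℕ K) where
  carrier := {f | ∀ e : Equiv.Perm ℕ, MvPowerSeries.renameEquiv K e f = f}
  mul_mem' hf hg e := by rw [map_mul, hf e, hg e]
  add_mem' hf hg e := by rw [map_add, hf e, hg e]
  algebraMap_mem' r e := AlgEquiv.commutes _ r

/-- The ring `Λ` of symmetric functions over `ℝ(q)` as a subset of the power series: symmetric
power series of bounded degree. -/
def Lam : Set (MvPowerSeries ℕ K) :=
  {f | f ∈ LamHat ∧ ∃ N : ℕ, ∀ d : ℕ →₀ ℕ, MvPowerSeries.coeff d f ≠ 0 → d.degree ≤ N}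

theorem coeff_renameEquiv (e : Equiv.Perm ℕ) (f : MvPowerSeries ℕ K) (d : ℕ →₀ ℕ) :
    MvPowerSeries.coeff (d.mapDomain e) (MvPowerSeries.renameEquiv K e f) =
      MvPowerSeries.coeff d f := by
  have h := MvPowerSeries.coeff_embDomain_rename e.toEmbedding f d
  rw [Finsupp.embDomain_eq_mapDomain] at h
  exact h

theorem mem_LamHat_iff_coeff (f : MvPowerSeries ℕ K) :
    f ∈ LamHat ↔ ∀ (e : Equiv.Perm ℕ) (d : ℕ →₀ ℕ),
      MvPowerSeries.coeff (d.mapDomain e) f = MvPowerSeries.coeff d f := by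
  constructor
  · intro h e d
    conv_lhs => rw [← h e]
    exact coeff_renameEquiv e f d
  · intro h e
    ext d
    obtain ⟨d', rfl⟩ : ∃ d' : ℕ →₀ ℕ, d'.mapDomain e = d :=
      ⟨d.mapDomain e.symm, by rw [← Finsupp.mapDomain_comp]; simp⟩
    rw [coeff_renameEquiv, h]

/-- `LamHat` consists of the limits of sequences of `Lam` with respect to the degree filtration. -/
theorem mem_LamHat_iff (f : MvPowerSeries ℕ K) :
    f ∈ LamHat ↔ ∀ n : ℕ, ∃ g ∈ Lam, ∀ d : ℕ →₀ ℕ, d.degree < n →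
      MvPowerSeries.coeff d f = MvPowerSeries.coeff d g := by
  have hdeg : ∀ (e : Equiv.Perm ℕ) (d : ℕ →₀ ℕ), (d.mapDomain e).degree = d.degree :=
    fun e d => Finsupp.degree_mapDomain e d
  constructor
  · intro hf n
    rw [mem_LamHat_iff_coeff] at hf
    let g : MvPowerSeries ℕ K := fun d => if d.degree < n then MvPowerSeries.coeff d f else 0
    have hg : ∀ d, MvPowerSeries.coeff d g =
        if d.degree < n then MvPowerSeries.coeff d f else 0 := fun d => rfl
    refine ⟨g, ⟨?_, n, fun d hd => ?_⟩, fun d hd => ?_⟩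
    · rw [mem_LamHat_iff_coeff]
      intro e d
      rw [hg, hg, hdeg, hf]
    · by_contra hlt
      rw [hg, if_neg (by omega)] at hd
      exact hd rfl
    · rw [hg, if_pos hd]
  · intro h
    rw [mem_LamHat_iff_coeff]
    intro e d
    obtain ⟨g, hg, hfg⟩ := h (d.degree + 1)
    rw [hfg _ (by rw [hdeg]; omega), hfg _ (by omega)]
    exact (mem_LamHat_iff_coeff g).mp hg.1 e d

/-- `f = ∑_lam c_lam 𝔽_lam` as a possibly infinite linear combination, coefficient by coefficient.
For each monomial `d` the sum is finite, since every monomial of `𝔽_lam` has degree at least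
`|lam|`. -/
def IsExpansion (f : MvPowerSeries ℕ K) (c : YoungDiagram → K) : Prop :=
  ∀ d : ℕ →₀ ℕ, MvPowerSeries.coeff d f =
    ∑ᶠ lam : YoungDiagram, c lam * MvPowerSeries.coeff d (F lam)

end InhomQWhittaker

end

noncomputable section

namespace InhomQWhittaker

/-! ### Young diagrams through their row lengths -/

/-! On partitions with at most L parts, the one-variable skew polynomials form a matrix T(x) = ∑ T_k
x^k in the incidence algebra, and the branching rule makes the skew functions matrix elements of
T(x_0) T(x_1) ⋯. A second matrix D(x), supported on vertical strips (`dualWeight`), is a polynomial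
of degree at most L in x with D(0) = 1. Both are products of local weights over the rows, and local
identities give D(x) D(y) = D(y) D(x) (`sum_dualWeight_mul_comm`) and T(x) D(x) = (1 - x)^L T(q x)
(`sum_dualWeight_mul_oneVar`). As 1 - q^k ≠ 0 for k ≥ 1, the second equation determines T from D:
each T_k is a universal polynomial in D_1, …, D_L (`rho_genericSolution`). So the T_k commute, the
skew functions are symmetric, and the coefficient of x^d in any of them is a matrix element of one
element `monomialElt L d` of a polynomial ring in L variables (`coeff_skewF_eq`).

The coefficients of x^d in the F_λ are the entries of this element in the row of the empty
partition, and that row determines the element (`vacuumImage_injective`). Hence every linear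
functional of `monomialElt L d` yields a series expanding in the F_λ with ℓ(λ) ≤ L
(`exists_isExpansion`). Skew functions come from the other matrix elements. Products come from the
fact that solutions of the q-difference equation for L and M multiply to one for L + M.
Triangularity of the coefficients of x^λ gives uniqueness, and together with a bound on the degree
in x_0 it bounds the first rows; only finitely many λ remain.

For the coproduct, coefficient functionals separate tensors (`tensor_ext`), and paired with Δ f they
read off coefficients of f in a union of two alphabets (`pairing_comulLin`). The bialgebra axioms
then reduce to the symmetry and the multiplication of power series. -/

theorem ext_rowLen {a b : YoungDiagram} (h : ∀ r, a.rowLen r = b.rowLen r) : a = b := by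
  ext ⟨i, j⟩
  simp [YoungDiagram.mem_iff_lt_rowLen, h]

theorem le_iff_rowLen {a b : YoungDiagram} : a ≤ b ↔ ∀ r, a.rowLen r ≤ b.rowLen r := by
  constructor
  · intro h r
    by_contra hlt
    push Not at hlt
    have h1 : (r, b.rowLen r) ∈ a := YoungDiagram.mem_iff_lt_rowLen.mpr hlt
    have h2 : (r, b.rowLen r) ∈ b := h h1
    exact lt_irrefl _ (YoungDiagram.mem_iff_lt_rowLen.mp h2)
  · rintro h ⟨i, j⟩ hij
    exact YoungDiagram.mem_iff_lt_rowLen.mpr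
      ((YoungDiagram.mem_iff_lt_rowLen.mp hij).trans_le (h i))

theorem colLen_zero_le_iff {a : YoungDiagram} {L : ℕ} : a.colLen 0 ≤ L ↔ a.rowLen L = 0 := by
  have h : L < a.colLen 0 ↔ 0 < a.rowLen L := by
    rw [← YoungDiagram.mem_iff_lt_colLen, ← YoungDiagram.mem_iff_lt_rowLen]
  omega

theorem rowLen_eq_zero {a : YoungDiagram} {L r : ℕ} (h : a.colLen 0 ≤ L) (hr : L ≤ r) :
    a.rowLen r = 0 :=
  colLen_zero_le_iff.mp (h.trans hr)

theorem rowLen_succ_le (a : YoungDiagram) (r : ℕ) : a.rowLen (r + 1) ≤ a.rowLen r :=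
  a.rowLen_anti r (r + 1) (Nat.le_succ r)

@[simp] theorem rowLen_bot (r : ℕ) : (⊥ : YoungDiagram).rowLen r = 0 := by
  by_contra h
  exact YoungDiagram.notMem_bot (r, 0)
    (YoungDiagram.mem_iff_lt_rowLen.mpr (Nat.pos_of_ne_zero h))

@[simp] theorem colLen_bot (r : ℕ) : (⊥ : YoungDiagram).colLen r = 0 := by
  by_contra h
  exact YoungDiagram.notMem_bot (0, r)
    (YoungDiagram.mem_iff_lt_colLen.mpr (Nat.pos_of_ne_zero h))

theorem colLen_zero_mono {a b : YoungDiagram} (h : a ≤ b) : a.colLen 0 ≤ b.colLen 0 := by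
  rw [colLen_zero_le_iff]
  have := le_iff_rowLen.mp h (b.colLen 0)
  rw [rowLen_eq_zero le_rfl le_rfl] at this
  omega

/-- The Young diagram whose row lengths are given by an antitone sequence that vanishes at `L`. -/
def ofFun (a : ℕ → ℕ) (ha : Antitone a) (L : ℕ) (_hL : a L = 0) : YoungDiagram where
  cells := (Finset.range L ×ˢ Finset.range (a 0)).filter fun c => c.2 < a c.1
  isLowerSet := by
    rintro ⟨i, j⟩ ⟨i', j'⟩ hle hc
    obtain ⟨h1, h2⟩ : i' ≤ i ∧ j' ≤ j := hle
    simp only [Finset.coe_filter, Finset.mem_product, Finset.mem_range, Set.mem_ofPred_eq] at hc ⊢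
    have := ha h1
    omega

@[simp] theorem rowLen_ofFun (a : ℕ → ℕ) (ha : Antitone a) (L : ℕ) (hL : a L = 0) (r : ℕ) :
    (ofFun a ha L hL).rowLen r = a r := by
  have h : ∀ j, j < (ofFun a ha L hL).rowLen r ↔ j < a r := by
    intro j
    rw [← YoungDiagram.mem_iff_lt_rowLen, ← YoungDiagram.mem_cells]
    simp only [ofFun, Finset.mem_filter, Finset.mem_product, Finset.mem_range]
    constructor
    · exact fun h => h.2
    · intro h
      refine ⟨⟨?_, h.trans_le (ha (Nat.zero_le r))⟩, h⟩
      by_contra hr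
      have := ha (not_lt.mp hr)
      omega
  have h1 := h (a r)
  have h2 := h ((ofFun a ha L hL).rowLen r)
  omega

theorem card_eq_sum {a : YoungDiagram} {L : ℕ} (h : a.colLen 0 ≤ L) :
    a.card = ∑ r ∈ Finset.range L, a.rowLen r := by
  have hmap : ∀ c ∈ a.cells, c.1 ∈ Finset.range L := by
    rintro ⟨i, j⟩ hc
    have := YoungDiagram.mem_iff_lt_rowLen.mp ((YoungDiagram.mem_cells _).mp hc)
    rw [Finset.mem_range]
    by_contra hi
    rw [rowLen_eq_zero h (not_lt.mp hi)] at this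
    omega
  rw [YoungDiagram.card, Finset.card_eq_sum_card_fiberwise hmap]
  exact Finset.sum_congr rfl fun r _ => by rw [YoungDiagram.rowLen_eq_card]; rfl

@[simp] theorem card_bot : (⊥ : YoungDiagram).card = 0 := rfl

theorem rowLen_le_card (a : YoungDiagram) (r : ℕ) : a.rowLen r ≤ a.card := by
  rw [YoungDiagram.rowLen_eq_card]
  exact Finset.card_le_card (Finset.filter_subset _ _)

theorem colLen_le_card (a : YoungDiagram) (r : ℕ) : a.colLen r ≤ a.card := by
  rw [YoungDiagram.colLen_eq_card]
  exact Finset.card_le_card (Finset.filter_subset _ _)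

theorem eq_of_le_of_card_le {a b : YoungDiagram} (h : a ≤ b) (hc : b.card ≤ a.card) : a = b :=
  YoungDiagram.ext (Finset.eq_of_subset_of_card_le h hc)

theorem finite_box (N L : ℕ) :
    {a : YoungDiagram | a.colLen 0 ≤ L ∧ a.rowLen 0 ≤ N}.Finite := by
  have hanti : Antitone fun i => if i < L then N else 0 := by
    intro i j hij
    dsimp only
    split_ifs <;> omega
  refine (finite_Iic (ofFun _ hanti L (by simp))).subset ?_
  rintro a ⟨h1, h2⟩
  rw [Set.mem_Iic, le_iff_rowLen]
  intro r
  rw [rowLen_ofFun]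
  split_ifs with hr
  · exact (a.rowLen_anti 0 r (Nat.zero_le r)).trans h2
  · exact (rowLen_eq_zero h1 (not_lt.mp hr)).le

theorem finite_card_le (n : ℕ) : {a : YoungDiagram | a.card ≤ n}.Finite :=
  (finite_box n n).subset fun a ha => ⟨(colLen_le_card a 0).trans ha, (rowLen_le_card a 0).trans ha⟩

/-- This interlacing form makes the strip condition local in the rows. If λ_{r+1} > μ_r (rows
indexed as in the statement), then column μ_r has boxes of λ/μ in both rows r and r + 1. -/
theorem horizontalStrip_iff {mu lam : YoungDiagram} :
    HorizontalStrip mu lam ↔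
      ∀ r, lam.rowLen (r + 1) ≤ mu.rowLen r ∧ mu.rowLen r ≤ lam.rowLen r := by
  constructor
  · rintro ⟨hle, h⟩ r
    refine ⟨?_, le_iff_rowLen.mp hle r⟩
    by_contra hlt
    push Not at hlt
    have h1 : ∀ i, i = r ∨ i = r + 1 → (i, mu.rowLen r) ∈ lam.cells \ mu.cells := by
      intro i hi
      rw [Finset.mem_sdiff, YoungDiagram.mem_cells, YoungDiagram.mem_cells,
        YoungDiagram.mem_iff_lt_rowLen, YoungDiagram.mem_iff_lt_rowLen]
      have h2 := rowLen_succ_le lam r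
      have h3 := rowLen_succ_le mu r
      rcases hi with rfl | rfl <;> omega
    have := h r (r + 1) _ (h1 r (Or.inl rfl)) (h1 (r + 1) (Or.inr rfl))
    omega
  · intro h
    refine ⟨le_iff_rowLen.mpr fun r => (h r).2, ?_⟩
    have key : ∀ i i' j : ℕ, (i, j) ∈ lam.cells \ mu.cells → (i', j) ∈ lam.cells \ mu.cells →
        i' ≤ i := by
      intro i i' j h1 h2
      rw [Finset.mem_sdiff, YoungDiagram.mem_cells, YoungDiagram.mem_cells,
        YoungDiagram.mem_iff_lt_rowLen, YoungDiagram.mem_iff_lt_rowLen] at h1 h2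
      by_contra hlt
      have h3 := (h i).1
      have h4 := lam.rowLen_anti (i + 1) i' (by omega)
      omega
    exact fun i i' j h1 h2 => le_antisymm (key i' i j h2 h1) (key i i' j h1 h2)

theorem sum_sub_rowLen (lam : YoungDiagram) (n : ℕ) :
    ∑ r ∈ Finset.range n, (lam.rowLen r - lam.rowLen (r + 1)) + lam.rowLen n = lam.rowLen 0 := by
  induction n with
  | zero => simp
  | succ n ih =>
    rw [Finset.sum_range_succ]
    have := rowLen_succ_le lam n
    omega

/-! ### Partitions of bounded length and their incidence algebra -/

/-- Partitions with at most `L` parts. -/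
abbrev BddLen (L : ℕ) : Type := {lam : YoungDiagram // lam.colLen 0 ≤ L}

open scoped Classical in
instance (L : ℕ) : LocallyFiniteOrder (BddLen L) :=
  LocallyFiniteOrder.ofIcc _
    (fun a b => ((below b.1).filter fun x => a.1 ≤ x).subtype fun x => x.colLen 0 ≤ L)
    (fun a b x => by
      rw [Finset.mem_subtype, Finset.mem_filter, mem_below]
      exact and_comm)

theorem sum_Icc_bddLen {M : Type*} [AddCommMonoid M] {L : ℕ} (a b : BddLen L)
    (p : YoungDiagram → Prop) [DecidablePred p]
    (f : YoungDiagram → M) (hp : ∀ x : YoungDiagram, x ≤ b.1 → (p x ↔ a.1 ≤ x)) :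
    ∑ x ∈ Finset.Icc a b, f x.1 = ∑ x ∈ (below b.1).filter p, f x := by
  classical
  refine Finset.sum_bij (fun x _ => x.1) ?_ ?_ ?_ ?_
  · intro x hx
    rw [Finset.mem_Icc] at hx
    rw [Finset.mem_filter, mem_below]
    exact ⟨hx.2, (hp _ hx.2).mpr hx.1⟩
  · intro x _ y _ h
    exact Subtype.ext h
  · intro x hx
    rw [Finset.mem_filter, mem_below] at hx
    exact ⟨⟨x, (colLen_zero_mono hx.1).trans b.2⟩,
      Finset.mem_Icc.mpr ⟨(hp _ hx.1).mp hx.2, hx.1⟩, rfl⟩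
  · intros
    rfl

/-! ### Sums over vertical strips as transfer matrix products -/

/-- Partial products of the transfer matrices `G 0, G 1, …` with two states `0` and `1`. -/
def transfer {R : Type*} [CommRing R] (G : ℕ → ℤ → ℤ → R) : ℕ → ℤ → R
  | 0, _ => 1
  | k + 1, e => transfer G k 0 * G k 0 e + transfer G k 1 * G k 1 e

/-- Expanding the matrix product gives one term per state sequence. A sequence is encoded by the set
of rows in state 1, and the last row sees the boundary state `e`. -/
theorem transfer_eq_sum_powerset {R : Type*} [CommRing R] (G : ℕ → ℤ → ℤ → R) (L : ℕ) (e : ℤ) :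
    transfer G L e = ∑ s ∈ (Finset.range L).powerset, ∏ r ∈ Finset.range L,
      G r (if r ∈ s then 1 else 0) (if r + 1 = L then e else if r + 1 ∈ s then 1 else 0) := by
  induction L generalizing e with
  | zero => simp [transfer]
  | succ L ih =>
    have hL : L ∉ Finset.range L := Finset.notMem_range_self
    rw [transfer, Finset.range_add_one, Finset.sum_powerset_insert hL, ih, ih, Finset.sum_mul,
      Finset.sum_mul]
    congr 1
    · refine Finset.sum_congr rfl fun s hs => ?_
      have hLs : L ∉ s := fun h => hL (Finset.mem_powerset.mp hs h)
      rw [Finset.prod_insert hL, mul_comm, if_neg hLs, if_pos rfl]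
      congr 1
      refine Finset.prod_congr rfl fun r hr => ?_
      rw [Finset.mem_range] at hr
      rw [if_neg (show ¬ r + 1 = L + 1 by omega)]
      split_ifs with h1 h2 h2 <;> first | rfl | (subst_vars; contradiction)
    · refine Finset.sum_congr rfl fun s hs => ?_
      have hLs : L ∉ s := fun h => hL (Finset.mem_powerset.mp hs h)
      rw [Finset.prod_insert hL, mul_comm, if_pos (Finset.mem_insert_self L s), if_pos rfl]
      congr 1
      refine Finset.prod_congr rfl fun r hr => ?_
      rw [Finset.mem_range] at hr
      rw [if_neg (show ¬ r + 1 = L + 1 by omega)]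
      have h1 : r ∈ insert L s ↔ r ∈ s := by
        rw [Finset.mem_insert, or_iff_right (by omega)]
      have h2 : r + 1 ∈ insert L s ↔ r + 1 = L ∨ r + 1 ∈ s := Finset.mem_insert
      simp only [h1, h2]
      by_cases h3 : r + 1 = L <;> simp [h3]

/-- By `hG`, a diagram of non-zero weight loses 0 or 1 box in each row, so it is encoded by the set
of rows losing a box. A set that does not come from a diagram contains some r but not r + 1 with
rows r and r + 1 equal, and `hG'` kills its term. -/
theorem sum_below_eq_transfer {R : Type*} [CommRing R] {L : ℕ} {lam : YoungDiagram}
    (hlam : lam.colLen 0 ≤ L) (G : ℕ → ℤ → ℤ → R)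
    (hG : ∀ r < L, ∀ a b, a ≠ 0 → a ≠ 1 → G r a b = 0)
    (hG' : ∀ r < L, lam.rowLen r = lam.rowLen (r + 1) → G r 1 0 = 0) :
    ∑ nu ∈ below lam, ∏ r ∈ Finset.range L,
      G r ((lam.rowLen r : ℤ) - nu.rowLen r) ((lam.rowLen (r + 1) : ℤ) - nu.rowLen (r + 1)) =
      transfer G L 0 := by
  classical
  have hzero : ∀ {nu : YoungDiagram} {r : ℕ}, nu ≤ lam → L ≤ r →
      lam.rowLen r = 0 ∧ nu.rowLen r = 0 := fun h hr =>
    ⟨rowLen_eq_zero hlam hr, rowLen_eq_zero ((colLen_zero_mono h).trans hlam) hr⟩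
  have hdiff : ∀ {nu : YoungDiagram}, nu ∈ below lam → ∏ r ∈ Finset.range L,
      G r ((lam.rowLen r : ℤ) - nu.rowLen r) ((lam.rowLen (r + 1) : ℤ) - nu.rowLen (r + 1)) ≠ 0 →
      ∀ r, (lam.rowLen r : ℤ) - nu.rowLen r = if lam.rowLen r ≠ nu.rowLen r then 1 else 0 := by
    intro nu hnu h r
    by_cases hr : r < L
    · split_ifs with h3
      · by_contra h4
        exact h (Finset.prod_eq_zero (Finset.mem_range.mpr hr) (hG r hr _ _ (by omega) h4))
      · omega
    · have := hzero (mem_below.mp hnu) (not_lt.mp hr)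
      simp [this]
  rw [transfer_eq_sum_powerset]
  refine Finset.sum_bij_ne_zero
    (fun nu _ _ => (Finset.range L).filter fun r => lam.rowLen r ≠ nu.rowLen r) ?_ ?_ ?_ ?_
  · intro nu _ _
    exact Finset.mem_powerset.mpr (Finset.filter_subset _ _)
  · intro nu hnu h nu' hnu' h' heq
    refine ext_rowLen fun r => ?_
    by_cases hr : r < L
    · have h1 : (lam.rowLen r ≠ nu.rowLen r) ↔ (lam.rowLen r ≠ nu'.rowLen r) := by
        have := Finset.ext_iff.mp heq r
        simpa [hr] using this
      have h2 := hdiff hnu h r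
      have h3 := hdiff hnu' h' r
      simp only [h1] at h2
      omega
    · rw [(hzero (mem_below.mp hnu) (not_lt.mp hr)).2, (hzero (mem_below.mp hnu') (not_lt.mp hr)).2]
  · intro s hs hne
    have hsub := Finset.mem_powerset.mp hs
    have hLs : ∀ r, L ≤ r → r ∉ s := fun r hr h => by
      have := Finset.mem_range.mp (hsub h)
      omega
    have hstep : ∀ r ∈ s, r + 1 ∉ s → lam.rowLen r ≠ lam.rowLen (r + 1) := by
      intro r hr hr' heq
      have hrL := Finset.mem_range.mp (hsub hr)
      refine hne (Finset.prod_eq_zero (hsub hr) ?_)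
      rw [if_pos hr, if_neg hr', ite_self]
      exact hG' r hrL heq
    -- An empty row in `s` would force every later row into `s`, past the bound `L`.
    have hpos : ∀ r ∈ s, 1 ≤ lam.rowLen r := by
      intro r hr
      by_contra h0
      have hall : ∀ k, r + k ∈ s := by
        intro k
        induction k with
        | zero => exact hr
        | succ k ih =>
          by_contra hk
          have h1 := hstep _ ih hk
          have h2 := lam.rowLen_anti r (r + k) (by omega)
          have h3 := lam.rowLen_anti r (r + k + 1) (by omega)
          omega
      exact hLs _ (Nat.le_add_left L r) (hall L)
    have hanti : Antitone fun r => lam.rowLen r - if r ∈ s then 1 else 0 := by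
      refine antitone_nat_of_succ_le fun r => ?_
      have h1 := rowLen_succ_le lam r
      have h2 := hstep r
      split_ifs with h3 h4 h4
      · omega
      · omega
      · have := h2 h4 h3
        omega
      · omega
    have hLz : lam.rowLen L - (if L ∈ s then 1 else 0) = 0 := by
      rw [rowLen_eq_zero hlam le_rfl, Nat.zero_sub]
    have hle : ofFun _ hanti L hLz ≤ lam := by
      rw [le_iff_rowLen]
      intro r
      rw [rowLen_ofFun]
      exact Nat.sub_le _ _
    have hd : ∀ r, (lam.rowLen r : ℤ) - (ofFun _ hanti L hLz).rowLen r =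
        if r ∈ s then 1 else 0 := by
      intro r
      rw [rowLen_ofFun]
      have := hpos r
      split_ifs with h <;> simp [h] at this ⊢
      omega
    refine ⟨ofFun _ hanti L hLz, mem_below.mpr hle, ?_, ?_⟩
    · convert hne using 1
      refine Finset.prod_congr rfl fun r _ => ?_
      rw [hd, hd]
      congr 1
      split_ifs with h1 h2 <;> first | rfl | exact absurd h1 (hLs _ h2.ge)
    · ext r
      have h1 := hd r
      rw [Finset.mem_filter]
      constructor
      · rintro ⟨_, h2⟩
        by_contra h3
        rw [if_neg h3] at h1
        omega
      · intro h2
        rw [if_pos h2] at h1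
        exact ⟨hsub h2, by omega⟩
  · intro nu hnu h
    refine Finset.prod_congr rfl fun r hr => ?_
    have hrL := Finset.mem_range.mp hr
    have h1 := hdiff hnu h
    rw [h1 r, h1 (r + 1)]
    congr 1
    · simp [hr]
    · by_cases h3 : r + 1 = L
      · have := hzero (mem_below.mp hnu) h3.ge
        rw [if_pos h3, this.1, this.2, if_neg (not_not.mpr rfl)]
      · simp [h3, show r + 1 < L by omega]

/-! ### The dual transfer matrix -/

/-- The local weights of the dual transfer matrix. -/
def localWeight {R : Type*} [CommRing R] (x Q : R) (a b : ℤ) : R :=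
  if a = 0 then (if b = 0 then 1 - Q * x else if b = 1 then 1 else 0)
  else if a = 1 then (if b = 0 then -(x * (1 - Q)) else if b = 1 then -x else 0)
  else 0

/-- The matrix elements of the dual transfer matrix on partitions with at most `L` parts. -/
def dualWeight {R : Type*} [CommRing R] [Algebra K R] (L : ℕ) (x : R) (lam nu : YoungDiagram) : R :=
  ∏ r ∈ Finset.range L,
    localWeight x (algebraMap K R (q ^ ((lam.rowLen r : ℤ) - lam.rowLen (r + 1))))
      ((lam.rowLen r : ℤ) - nu.rowLen r) ((lam.rowLen (r + 1) : ℤ) - nu.rowLen (r + 1))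

theorem localWeight_eq_zero {R : Type*} [CommRing R] (x Q : R) (a b : ℤ) (h0 : a ≠ 0)
    (h1 : a ≠ 1) : localWeight x Q a b = 0 := by
  rw [localWeight, if_neg h0, if_neg h1]

theorem map_dualWeight {R S : Type*} [CommRing R] [Algebra K R] [CommRing S] [Algebra K S]
    (f : R →ₐ[K] S) (L : ℕ) (x : R) (lam nu : YoungDiagram) :
    f (dualWeight L x lam nu) = dualWeight L (f x) lam nu := by
  rw [dualWeight, map_prod, dualWeight]
  refine Finset.prod_congr rfl fun r _ => ?_
  simp only [localWeight]
  split_ifs <;> simp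

theorem dualWeight_eq_zero {R : Type*} [CommRing R] [Algebra K R] {L : ℕ} (x : R)
    {lam nu : YoungDiagram} (hlam : lam.colLen 0 ≤ L) (hnu : nu.colLen 0 ≤ L) (h : ¬ nu ≤ lam) :
    dualWeight L x lam nu = 0 := by
  rw [le_iff_rowLen] at h
  push Not at h
  obtain ⟨r, hr⟩ := h
  have hrL : r < L := by
    by_contra hrL
    rw [rowLen_eq_zero hlam (not_lt.mp hrL), rowLen_eq_zero hnu (not_lt.mp hrL)] at hr
    omega
  exact Finset.prod_eq_zero (Finset.mem_range.mpr hrL)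
    (localWeight_eq_zero _ _ _ _ (by omega) (by omega))

theorem q_ne_zero : q ≠ 0 := RatFunc.X_ne_zero

/-- The transfer matrices for a product of two dual transfer matrices. -/
def twoLayer {R : Type*} [CommRing R] (qq qi : R) (x y : R) (Q : ℕ → R) (d : ℕ → ℤ)
    (r : ℕ) (a b : ℤ) : R :=
  localWeight x (Q r) a b *
    localWeight y (Q r * (if b - a = 1 then qq else if b - a = -1 then qi else 1))
      (d r - a) (d (r + 1) - b)

/-- `d r` is the number of boxes that the two layers remove together from row r. For the values 0
and 2 the intermediate state is forced; for 1 it is free, and the two partial sums do not agree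
after swapping x and y. The shape `al + be * x`, `al + qq * be * y` with common `al` and `be` is the
invariant that closes the induction. -/
theorem transfer_twoLayer {R : Type*} [CommRing R] {qq qi : R} (hq : qq * qi = 1) (x y : R)
    (Q : ℕ → R) (d : ℕ → ℤ) (k : ℕ) :
    (d k = 0 → transfer (twoLayer qq qi x y Q d) k 0 = transfer (twoLayer qq qi y x Q d) k 0) ∧
    (d k = 2 → transfer (twoLayer qq qi x y Q d) k 1 = transfer (twoLayer qq qi y x Q d) k 1) ∧
    (d k = 1 → ∃ al be : R,
      transfer (twoLayer qq qi x y Q d) k 0 = al + be * x ∧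
      transfer (twoLayer qq qi x y Q d) k 1 = al + qq * be * y ∧
      transfer (twoLayer qq qi y x Q d) k 0 = al + be * y ∧
      transfer (twoLayer qq qi y x Q d) k 1 = al + qq * be * x) := by
  induction k with
  | zero =>
    refine ⟨fun _ => rfl, fun _ => rfl, fun _ => ⟨1, 0, ?_, ?_, ?_, ?_⟩⟩ <;> simp [transfer]
  | succ k ih =>
    obtain ⟨ih0, ih2, ih1⟩ := ih
    simp only [transfer]
    by_cases h0 : d k = 0
    · have e := ih0 h0
      refine ⟨fun h => ?_, fun h => ?_, fun h => ⟨transfer (twoLayer qq qi y x Q d) k 0,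
        -(Q k * transfer (twoLayer qq qi y x Q d) k 0), ?_, ?_, ?_, ?_⟩⟩ <;>
      simp only [twoLayer, localWeight, h0, h, e] <;> (try norm_num) <;> ring
    by_cases h2 : d k = 2
    · have e := ih2 h2
      refine ⟨fun h => ?_, fun h => ?_, fun h =>
        ⟨transfer (twoLayer qq qi y x Q d) k 1 * (x * y * (1 - Q k)),
        0, ?_, ?_, ?_, ?_⟩⟩ <;>
      simp only [twoLayer, localWeight, h2, h, e] <;> (try norm_num) <;>
      ring
    by_cases h1 : d k = 1
    · obtain ⟨al, be, e1, e2, e3, e4⟩ := ih1 h1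
      refine ⟨fun h => ?_, fun h => ?_, fun h => ⟨-al * (x + y - Q k * x * y) -
        be * x * y * (1 + qq - qq * Q k), Q k * (al + be * x * y), ?_, ?_, ?_, ?_⟩⟩ <;>
      simp only [twoLayer, localWeight, h1, h, e1, e2, e3, e4] <;> (try norm_num) <;>
      -- Only the passage from `d k = 1` to `d (k + 1) = 0` involves `qi`; there it meets the factor
      -- `qq` of the invariant, and `hq` cancels the pair.
      first
      | ring1
      | linear_combination (be * x * y * Q k * (1 - Q k) * (y - x)) * hq
    · have hz : ∀ x y : R, ∀ b, twoLayer qq qi x y Q d k 0 b = 0 ∧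
          twoLayer qq qi x y Q d k 1 b = 0 := by
        intro x y b
        constructor
        · rw [twoLayer, localWeight_eq_zero y, mul_zero] <;> omega
        · rw [twoLayer, localWeight_eq_zero y, mul_zero] <;> omega
      simp only [hz, mul_zero, add_zero]
      exact ⟨fun _ => trivial, fun _ => trivial, fun _ => ⟨0, 0, by simp⟩⟩

/-- The second layer depends on ν_r - ν_{r+1}, which differs from λ_r - λ_{r+1} by b - a ∈ {-1, 0,
1}. The factors q and q⁻¹ in `twoLayer` record this shift, so that the weights involve only local
states. -/
theorem sum_dualWeight_mul {R : Type*} [CommRing R] [Algebra K R] {L : ℕ} (x y : R)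
    {lam mu : YoungDiagram} (hlam : lam.colLen 0 ≤ L) :
    ∑ nu ∈ below lam, dualWeight L x lam nu * dualWeight L y nu mu =
      transfer (twoLayer (algebraMap K R q) (algebraMap K R q⁻¹) x y
        (fun r => algebraMap K R (q ^ ((lam.rowLen r : ℤ) - lam.rowLen (r + 1))))
        (fun r => (lam.rowLen r : ℤ) - mu.rowLen r)) L 0 := by
  rw [← sum_below_eq_transfer hlam]
  · refine Finset.sum_congr rfl fun nu _ => ?_
    rw [dualWeight, dualWeight, ← Finset.prod_mul_distrib]
    refine Finset.prod_congr rfl fun r _ => ?_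
    rw [twoLayer]
    by_cases h : ((lam.rowLen r : ℤ) - nu.rowLen r = 0 ∨ (lam.rowLen r : ℤ) - nu.rowLen r = 1) ∧
      ((lam.rowLen (r + 1) : ℤ) - nu.rowLen (r + 1) = 0 ∨
        (lam.rowLen (r + 1) : ℤ) - nu.rowLen (r + 1) = 1)
    · congr 1
      have hQ : algebraMap K R (q ^ ((nu.rowLen r : ℤ) - nu.rowLen (r + 1))) =
          algebraMap K R (q ^ ((lam.rowLen r : ℤ) - lam.rowLen (r + 1))) *
          (if (lam.rowLen (r + 1) : ℤ) - nu.rowLen (r + 1) - (lam.rowLen r - nu.rowLen r) = 1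
            then algebraMap K R q else
            if (lam.rowLen (r + 1) : ℤ) - nu.rowLen (r + 1) - (lam.rowLen r - nu.rowLen r) = -1
            then algebraMap K R q⁻¹ else 1) := by
        obtain ⟨h1 | h1, h2 | h2⟩ := h <;> simp only [h1, h2]
        · rw [show (nu.rowLen r : ℤ) - nu.rowLen (r + 1) = lam.rowLen r - lam.rowLen (r + 1) by
            omega]
          simp
        · rw [show (nu.rowLen r : ℤ) - nu.rowLen (r + 1) = lam.rowLen r - lam.rowLen (r + 1) + 1 by
            omega, zpow_add₀ q_ne_zero]
          simp
        · rw [show (nu.rowLen r : ℤ) - nu.rowLen (r + 1) = lam.rowLen r - lam.rowLen (r + 1) + -1 by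
            omega, zpow_add₀ q_ne_zero, map_mul]
          simp
        · rw [show (nu.rowLen r : ℤ) - nu.rowLen (r + 1) = lam.rowLen r - lam.rowLen (r + 1) by
            omega]
          simp
      rw [hQ]
      congr 1 <;> ring
    · have hz : localWeight x
          (algebraMap K R (q ^ ((lam.rowLen r : ℤ) - lam.rowLen (r + 1))))
          ((lam.rowLen r : ℤ) - nu.rowLen r)
          ((lam.rowLen (r + 1) : ℤ) - nu.rowLen (r + 1)) = 0 := by
        rw [localWeight]
        split_ifs <;> first | rfl | (exfalso; omega)
      rw [hz, zero_mul, zero_mul]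
  · intro r _ a b h0 h1
    rw [twoLayer, localWeight_eq_zero _ _ _ _ h0 h1, zero_mul]
  · intro r _ h
    simp [twoLayer, localWeight, h]

theorem sum_dualWeight_mul_comm {R : Type*} [CommRing R] [Algebra K R] {L : ℕ} (x y : R)
    {lam mu : YoungDiagram} (hlam : lam.colLen 0 ≤ L) (hmu : mu.colLen 0 ≤ L) :
    ∑ nu ∈ below lam, dualWeight L x lam nu * dualWeight L y nu mu =
      ∑ nu ∈ below lam, dualWeight L y lam nu * dualWeight L x nu mu := by
  rw [sum_dualWeight_mul x y hlam, sum_dualWeight_mul y x hlam]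
  -- Row `L` is empty in both diagrams, so the symmetric case `d L = 0` applies.
  refine (transfer_twoLayer ?_ x y _ _ L).1 ?_
  · rw [← map_mul, mul_inv_cancel₀ q_ne_zero, map_one]
  · rw [rowLen_eq_zero hlam le_rfl, rowLen_eq_zero hmu le_rfl, sub_self]

/-! ### The `q`-difference equation of the transfer matrix -/

/-- The `q`-binomial coefficient `[a + b, a]`. -/
def qBinom (a b : ℕ) : K := qPoch q q (a + b) / (qPoch q q a * qPoch q q b)

theorem qPoch_succ {R : Type*} [CommRing R] (a p : R) (k : ℕ) :
    qPoch a p (k + 1) = qPoch a p k * (1 - a * p ^ k) :=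
  Finset.prod_range_succ _ _

theorem qPoch_succ' {R : Type*} [CommRing R] (a p : R) (k : ℕ) :
    qPoch a p (k + 1) = (1 - a) * qPoch (p * a) p k := by
  rw [qPoch, Finset.prod_range_succ', pow_zero, mul_one, mul_comm]
  congr 1
  exact Finset.prod_congr rfl fun i _ => by ring

theorem map_qPoch {R S : Type*} [CommRing R] [CommRing S] (f : R →+* S) (a p : R) (k : ℕ) :
    f (qPoch a p k) = qPoch (f a) (f p) k := by
  simp [qPoch, map_prod]

@[simp] theorem qPoch_zero {R : Type*} [CommRing R] (a p : R) : qPoch a p 0 = 1 := rfl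

theorem one_sub_q_pow_ne_zero {k : ℕ} (hk : k ≠ 0) : (1 - q ^ k : K) ≠ 0 := by
  obtain ⟨k, rfl⟩ := Nat.exists_eq_succ_of_ne_zero hk
  have h := qPoch_q_ne_zero (k + 1)
  rw [qPoch_succ] at h
  rw [Nat.succ_eq_add_one, pow_succ']
  exact right_ne_zero_of_mul h

theorem qBinom_succ_left (a b : ℕ) :
    (1 - q ^ (a + 1)) * qBinom (a + 1) b = (1 - q ^ (a + b + 1)) * qBinom a b := by
  have h1 := qPoch_q_ne_zero a
  have h2 := qPoch_q_ne_zero b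
  have h3 := one_sub_q_pow_ne_zero (Nat.succ_ne_zero a)
  rw [qBinom, qBinom, show a + 1 + b = a + b + 1 by ring, qPoch_succ, qPoch_succ,
    ← pow_succ', ← pow_succ']
  rw [Nat.succ_eq_add_one] at h3
  field_simp

theorem qBinom_succ_right (a b : ℕ) :
    (1 - q ^ (b + 1)) * qBinom a (b + 1) = (1 - q ^ (a + b + 1)) * qBinom a b := by
  have h1 := qPoch_q_ne_zero a
  have h2 := qPoch_q_ne_zero b
  have h3 := one_sub_q_pow_ne_zero (Nat.succ_ne_zero b)
  rw [qBinom, qBinom, show a + (b + 1) = a + b + 1 by ring, qPoch_succ, qPoch_succ,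
    ← pow_succ', ← pow_succ']
  rw [Nat.succ_eq_add_one] at h3
  field_simp

@[simp] theorem qBinom_zero_left (b : ℕ) : qBinom 0 b = 1 := by
  simp [qBinom, qPoch_q_ne_zero]

@[simp] theorem qBinom_zero_right (a : ℕ) : qBinom a 0 = 1 := by
  simp [qBinom, qPoch_q_ne_zero]

theorem qBinom_pascal (a b : ℕ) :
    qBinom (a + 1) (b + 1) = q ^ (a + 1) * qBinom (a + 1) b + qBinom a (b + 1) := by
  have h1 := one_sub_q_pow_ne_zero (Nat.succ_ne_zero b)
  rw [Nat.succ_eq_add_one] at h1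
  apply mul_left_cancel₀ h1
  have e1 := qBinom_succ_right (a + 1) b
  have e2 := qBinom_succ_right a b
  have e3 := qBinom_succ_left a b
  rw [mul_add, e1, e2, ← e3]
  ring

/-- The weight of one row in the one-variable skew polynomial. -/
def rowWeight (a b : ℤ) : Polynomial K :=
  if 0 ≤ a ∧ 0 ≤ b then
    Polynomial.X ^ a.toNat *
      (qPoch Polynomial.X (Polynomial.C q) b.toNat * Polynomial.C (qBinom a.toNat b.toNat))
  else 0

theorem rowWeight_natCast (a b : ℕ) : rowWeight a b = Polynomial.X ^ a *
    (qPoch Polynomial.X (Polynomial.C q) b * Polynomial.C (qBinom a b)) := by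
  rw [rowWeight, if_pos ⟨Int.natCast_nonneg _, Int.natCast_nonneg _⟩, Int.toNat_natCast,
    Int.toNat_natCast]

theorem rowWeight_of_neg_left {a b : ℤ} (h : a < 0) : rowWeight a b = 0 :=
  if_neg fun h' => by omega

theorem rowWeight_of_neg_right {a b : ℤ} (h : b < 0) : rowWeight a b = 0 :=
  if_neg fun h' => by omega

/-- A row weight vanishes as soon as one of its arguments is negative, that is, where interlacing
fails. This absorbs the strip condition into the product, and rows beyond the length contribute 1.
-/
theorem oneVar_eq_prod {L : ℕ} {lam mu : YoungDiagram} (hlam : lam.colLen 0 ≤ L)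
    (hmu : mu.colLen 0 ≤ L) :
    oneVar lam mu = ∏ r ∈ Finset.range L,
      rowWeight ((lam.rowLen r : ℤ) - mu.rowLen r) ((mu.rowLen r : ℤ) - lam.rowLen (r + 1)) := by
  rw [oneVar]
  split_ifs with h
  · have hs := horizontalStrip_iff.mp h
    have hcard : lam.card - mu.card = ∑ r ∈ Finset.range L, (lam.rowLen r - mu.rowLen r) := by
      rw [card_eq_sum hlam, card_eq_sum hmu,
        ← Finset.sum_tsub_distrib _ fun r _ => (hs r).2]
    have hfac : ∀ r, rowWeight ((lam.rowLen r : ℤ) - mu.rowLen r)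
        ((mu.rowLen r : ℤ) - lam.rowLen (r + 1)) =
        Polynomial.X ^ (lam.rowLen r - mu.rowLen r) *
        (qPoch Polynomial.X (Polynomial.C q) (mu.rowLen r - lam.rowLen (r + 1)) *
          Polynomial.C (qPoch q q (lam.rowLen r - lam.rowLen (r + 1)) /
            (qPoch q q (lam.rowLen r - mu.rowLen r) *
              qPoch q q (mu.rowLen r - lam.rowLen (r + 1))))) := by
      intro r
      rw [← Nat.cast_sub (hs r).2, ← Nat.cast_sub (hs r).1, rowWeight_natCast, qBinom,
        show lam.rowLen r - mu.rowLen r + (mu.rowLen r - lam.rowLen (r + 1)) =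
          lam.rowLen r - lam.rowLen (r + 1) by have := hs r; omega]
    rw [Finset.prod_congr rfl fun r _ => hfac r,
      Finset.prod_mul_distrib (f := fun r => Polynomial.X ^ (lam.rowLen r - mu.rowLen r)),
      Finset.prod_pow_eq_pow_sum, ← hcard]
    congr 1
    refine Finset.prod_subset (Finset.range_mono hlam) fun r _ hr => ?_
    have h1 := rowLen_eq_zero le_rfl (not_lt.mp (mt Finset.mem_range.mpr hr))
    have h2 := (hs r).2
    rw [h1, show mu.rowLen r = 0 by omega]
    simp
  · rw [horizontalStrip_iff] at h
    push Not at h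
    obtain ⟨r, hr⟩ := h
    have hrL : r < L := by
      by_contra hrL
      have h1 := rowLen_eq_zero hlam (not_lt.mp hrL)
      have h2 := rowLen_eq_zero hlam (show L ≤ r + 1 by omega)
      have h3 := rowLen_eq_zero hmu (not_lt.mp hrL)
      omega
    refine (Finset.prod_eq_zero (Finset.mem_range.mpr hrL) ?_).symm
    by_cases h1 : lam.rowLen (r + 1) ≤ mu.rowLen r
    · exact rowWeight_of_neg_left (by have := hr h1; omega)
    · exact rowWeight_of_neg_right (by omega)

theorem oneVar_eq_zero {lam mu : YoungDiagram} (h : ¬ mu ≤ lam) : oneVar lam mu = 0 :=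
  if_neg fun h' => h h'.1

/-- The right-hand side of the `q`-difference equation for one row. -/
def shiftedRowWeight (a b : ℤ) : Polynomial K :=
  (1 - Polynomial.X) * (rowWeight a b).comp (Polynomial.C q * Polynomial.X)

theorem shiftedRowWeight_natCast (a b : ℕ) : shiftedRowWeight a b =
    (Polynomial.C q * Polynomial.X) ^ a *
      (qPoch Polynomial.X (Polynomial.C q) (b + 1) * Polynomial.C (qBinom a b)) := by
  rw [shiftedRowWeight, rowWeight_natCast, qPoch_succ']
  have h : (qPoch Polynomial.X (Polynomial.C q) b).comp (Polynomial.C q * Polynomial.X) =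
      qPoch (Polynomial.C q * Polynomial.X) (Polynomial.C q) b := by
    have := map_qPoch (Polynomial.compRingHom (Polynomial.C q * Polynomial.X)) Polynomial.X
      (Polynomial.C q) b
    simpa using this
  rw [Polynomial.mul_comp, Polynomial.mul_comp, h, Polynomial.pow_comp, Polynomial.X_comp,
    Polynomial.C_comp]
  ring

/-- The local form of the q-difference equation: a box removed from the row lowers `a`, and `e`
boxes removed from the next row raise `b` by `e`. Independence of the right-hand side from `e`
decouples the rows. For e = 0 the ratio of neighbouring q-binomials is used, for e = 1 the q-Pascal
rule. -/
theorem sum_localWeight_mul_rowWeight (a b : ℤ) (hab : 0 ≤ a + b) (e : ℤ) (he : e = 0 ∨ e = 1) :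
    localWeight Polynomial.X (Polynomial.C (q ^ (a + b))) 0 e * rowWeight a (b + e) +
      localWeight Polynomial.X (Polynomial.C (q ^ (a + b))) 1 e * rowWeight (a - 1) (b + e) =
      shiftedRowWeight a b := by
  have hzero : a < 0 ∨ b < 0 → shiftedRowWeight a b = 0 := by
    rintro (h | h)
    · rw [shiftedRowWeight, rowWeight_of_neg_left h, Polynomial.zero_comp, mul_zero]
    · rw [shiftedRowWeight, rowWeight_of_neg_right h, Polynomial.zero_comp, mul_zero]
  by_cases ha : a < 0
  · rw [hzero (Or.inl ha), rowWeight_of_neg_left ha, rowWeight_of_neg_left (by omega)]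
    simp
  obtain ⟨a, rfl⟩ := Int.eq_ofNat_of_zero_le (not_lt.mp ha)
  by_cases hb : b < 0
  · rw [hzero (Or.inr hb)]
    by_cases hbe : b + e < 0
    · rw [rowWeight_of_neg_right hbe, rowWeight_of_neg_right hbe]
      simp
    -- Here the right-hand side is zero although both terms on the left are not; they cancel.
    obtain ⟨rfl, rfl⟩ : b = -1 ∧ e = 1 := by omega
    obtain ⟨a, rfl⟩ : ∃ a', a = a' + 1 := ⟨a - 1, by omega⟩
    have h1 := rowWeight_natCast (a + 1) 0
    have h2 := rowWeight_natCast a 0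
    push_cast at h1 h2
    simp only [localWeight, neg_add_cancel, Nat.cast_add, Nat.cast_one, add_sub_cancel_right, h1,
      h2]
    norm_num
    ring
  obtain ⟨b, rfl⟩ := Int.eq_ofNat_of_zero_le (not_lt.mp hb)
  rw [shiftedRowWeight_natCast, ← Nat.cast_add, zpow_natCast]
  obtain rfl | rfl := he
  · rw [add_zero, rowWeight_natCast]
    obtain _ | a := a
    · rw [rowWeight_of_neg_left (by simp)]
      simp [localWeight, qPoch_succ]
      ring
    · rw [Nat.cast_add, Nat.cast_one, add_sub_cancel_right, rowWeight_natCast, qPoch_succ]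
      have h := congrArg Polynomial.C (qBinom_succ_left a b)
      simp only [Polynomial.C_mul, Polynomial.C_sub, Polynomial.C_pow, Polynomial.C_1] at h
      simp only [localWeight, if_true, one_ne_zero, if_false, Polynomial.C_pow]
      rw [show a + 1 + b = a + b + 1 by ring]
      linear_combination (Polynomial.X ^ (a + 1) * qPoch Polynomial.X (Polynomial.C q) b) * h
  · rw [← Nat.cast_one, ← Nat.cast_add, rowWeight_natCast]
    obtain _ | a := a
    · rw [rowWeight_of_neg_left (by simp)]
      simp [localWeight]
    · have h1 : ((a + 1 : ℕ) : ℤ) - (1 : ℕ) = a := by push_cast; ring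
      rw [h1, rowWeight_natCast, qBinom_pascal]
      simp only [localWeight, Nat.cast_one, if_true, one_ne_zero, if_false, Polynomial.C_pow,
        Polynomial.C_add, Polynomial.C_mul]
      ring

/-- The row vector (1, 1) is a common left eigenvector of the transfer matrices, with eigenvalues `B
r`. -/
theorem transfer_eq_prod {R : Type*} [CommRing R] (G : ℕ → ℤ → ℤ → R) (B : ℕ → R)
    (h : ∀ r e, e = 0 ∨ e = 1 → G r 0 e + G r 1 e = B r) (k : ℕ) (e : ℤ) (he : e = 0 ∨ e = 1) :
    transfer G k e = ∏ r ∈ Finset.range k, B r := by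
  induction k generalizing e with
  | zero => rfl
  | succ k ih =>
    rw [transfer, ih 0 (Or.inl rfl), ih 1 (Or.inr rfl), ← mul_add, h k e he,
      Finset.prod_range_succ]

/-- This is T(x) D(x) = (1 - x)^L T(q x) in matrix elements; each of the L rows contributes one
factor 1 - x. -/
theorem sum_dualWeight_mul_oneVar {L : ℕ} {lam mu : YoungDiagram} (hlam : lam.colLen 0 ≤ L)
    (hmu : mu.colLen 0 ≤ L) :
    ∑ nu ∈ below lam, dualWeight L Polynomial.X lam nu * oneVar nu mu =
      (1 - Polynomial.X) ^ L * (oneVar lam mu).comp (Polynomial.C q * Polynomial.X) := by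
  have h := sum_below_eq_transfer hlam
    (fun r a b => localWeight Polynomial.X
        (Polynomial.C (q ^ ((lam.rowLen r : ℤ) - lam.rowLen (r + 1)))) a b *
      rowWeight ((lam.rowLen r : ℤ) - mu.rowLen r - a)
        ((mu.rowLen r : ℤ) - lam.rowLen (r + 1) + b))
    (fun r _ a b h0 h1 => by rw [localWeight_eq_zero _ _ _ _ h0 h1, zero_mul])
    (fun r _ h => by simp [localWeight, h])
  rw [transfer_eq_prod _ (fun r => shiftedRowWeight ((lam.rowLen r : ℤ) - mu.rowLen r)
    ((mu.rowLen r : ℤ) - lam.rowLen (r + 1))) ?_ _ _ (Or.inl rfl)] at h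
  · rw [oneVar_eq_prod hlam hmu, Polynomial.prod_comp]
    have h2 : ((1 - Polynomial.X) ^ L : Polynomial K) =
        ∏ _r ∈ Finset.range L, (1 - Polynomial.X) := by simp
    rw [h2, ← Finset.prod_mul_distrib]
    refine Eq.trans (Finset.sum_congr rfl fun nu hnu => ?_) h
    rw [oneVar_eq_prod ((colLen_zero_mono (mem_below.mp hnu)).trans hlam) hmu, dualWeight,
      ← Finset.prod_mul_distrib]
    refine Finset.prod_congr rfl fun r _ => ?_
    rw [Polynomial.algebraMap_eq]
    congr 2 <;> ring
  · intro r e he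
    have h1 := rowLen_succ_le lam r
    have := sum_localWeight_mul_rowWeight ((lam.rowLen r : ℤ) - mu.rowLen r)
      ((mu.rowLen r : ℤ) - lam.rowLen (r + 1)) (by omega) e he
    rw [sub_add_sub_cancel] at this
    rw [← this, sub_zero]

open Finset.HasAntidiagonal (antidiagonal)

/-! ### The `q`-difference equation in a `K`-algebra -/

/-- Although `A` need not be commutative, the subalgebra generated by a commuting family is, so
evaluation can take place there. -/
theorem exists_mvPolynomial_algHom {ι A : Type*} [Ring A] [Algebra K A] (f : ι → A)
    (hf : ∀ i j, f i * f j = f j * f i) :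
    ∃ rho : MvPolynomial ι K →ₐ[K] A, ∀ i, rho (MvPolynomial.X i) = f i := by
  let S := Algebra.adjoin K (Set.range f)
  have hS : ∀ a ∈ Set.range f, ∀ b ∈ Set.range f, a * b = b * a := by
    rintro _ ⟨i, rfl⟩ _ ⟨j, rfl⟩
    exact hf i j
  have hcomm := Algebra.isMulCommutative_adjoin K hS
  let _ : CommRing S := { (inferInstance : Ring S) with mul_comm := hcomm.is_comm.comm }
  refine ⟨S.val.comp (MvPolynomial.aeval fun i => (⟨f i, Algebra.subset_adjoin ⟨i, rfl⟩⟩ : S)),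
    fun i => ?_⟩
  simp

/-- The sequence `t` solves the `q`-difference equation `t(q x) (1 - x) ^ L = t(x) c(x)`, where
`t(x)` and `c(x)` are the generating functions of the sequences. -/
def IsSolution {A : Type*} [Ring A] [Algebra K A] (L : ℕ) (c t : ℕ → A) : Prop :=
  ∀ k, ∑ ij ∈ antidiagonal k, t ij.2 * c ij.1 =
    ∑ ij ∈ antidiagonal k,
      (PowerSeries.coeff ij.1 ((1 - PowerSeries.X) ^ L : PowerSeries K) * q ^ ij.2) • t ij.2

theorem antidiagonal_sum_eq {M : Type*} [AddCommMonoid M] (k : ℕ) (f : ℕ × ℕ → M) :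
    ∑ ij ∈ antidiagonal k, f ij = f (0, k) + ∑ j ∈ Finset.range k, f (k - j, j) := by
  rw [Finset.Nat.sum_antidiagonal_eq_sum_range_succ_mk,
    ← Finset.sum_range_reflect, Finset.sum_range_succ, add_comm]
  congr 1
  · simp
  · refine Finset.sum_congr rfl fun j hj => ?_
    have := Finset.mem_range.mp hj
    congr 2; omega

theorem coeff_zero_one_sub_X_pow (L : ℕ) :
    PowerSeries.coeff 0 ((1 - PowerSeries.X) ^ L : PowerSeries K) = 1 := by
  simp

/-- The two terms containing `t k` combine to (1 - q^k) t_k. Since this scalar is invertible for k ≥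
1, the equation becomes a recursion that determines t from t_0. -/
theorem isSolution_iff {A : Type*} [Ring A] [Algebra K A] {L : ℕ} {c t : ℕ → A} (hc : c 0 = 1) :
    IsSolution L c t ↔ ∀ k, (1 - q ^ k : K) • t k =
      ∑ j ∈ Finset.range k,
        ((PowerSeries.coeff (k - j) ((1 - PowerSeries.X) ^ L : PowerSeries K) * q ^ j) • t j -
          t j * c (k - j)) := by
  refine forall_congr' fun k => ?_
  rw [antidiagonal_sum_eq, antidiagonal_sum_eq, hc, mul_one, coeff_zero_one_sub_X_pow, one_mul,
    Finset.sum_sub_distrib, sub_smul, one_smul]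
  constructor
  · intro h
    rw [sub_eq_sub_iff_add_eq_add, h, add_comm]
  · intro h
    rw [sub_eq_sub_iff_add_eq_add] at h
    rw [h, add_comm]

theorem IsSolution.unique {A : Type*} [Ring A] [Algebra K A] {L : ℕ} {c t t' : ℕ → A}
    (hc : c 0 = 1) (h0 : t 0 = t' 0) (h : IsSolution L c t) (h' : IsSolution L c t') (k : ℕ) :
    t k = t' k := by
  induction k using Nat.strong_induction_on with
  | _ k ih =>
    rcases eq_or_ne k 0 with rfl | hk
    · exact h0
    · have e := (isSolution_iff hc).mp h k
      have e' := (isSolution_iff hc).mp h' k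
      have h1 := one_sub_q_pow_ne_zero hk
      rw [← smul_right_inj h1, e, e']
      exact Finset.sum_congr rfl fun j hj => by rw [ih j (Finset.mem_range.mp hj)]

/-- The solution of the `q`-difference equation with initial value `1`. -/
def solution {A : Type*} [Ring A] [Algebra K A] (L : ℕ) (c : ℕ → A) : ℕ → A
  | 0 => 1
  | k + 1 => ((1 - q ^ (k + 1))⁻¹ : K) • ∑ j : Fin (k + 1),
      ((PowerSeries.coeff (k + 1 - j) ((1 - PowerSeries.X) ^ L : PowerSeries K) * q ^ (j : ℕ)) •
        solution L c j - solution L c j * c (k + 1 - j))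

theorem isSolution_solution {A : Type*} [Ring A] [Algebra K A] (L : ℕ) (c : ℕ → A)
    (hc : c 0 = 1) : IsSolution L c (solution L c) := by
  rw [isSolution_iff hc]
  intro k
  obtain _ | k := k
  · simp
  · rw [solution, smul_smul, mul_inv_cancel₀ (one_sub_q_pow_ne_zero (Nat.succ_ne_zero k)), one_smul,
      Finset.sum_range]

theorem IsSolution.map {A B : Type*} [Ring A] [Algebra K A] [Ring B] [Algebra K B] {L : ℕ}
    {c t : ℕ → A} (h : IsSolution L c t) (f : A →ₐ[K] B) :
    IsSolution L (fun k => f (c k)) fun k => f (t k) := by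
  intro k
  have := congrArg f (h k)
  simpa only [map_sum, map_mul, map_smul] using this

theorem isSolution_iff_powerSeries {A : Type*} [CommRing A] [Algebra K A] {L : ℕ} {c t : ℕ → A} :
    IsSolution L c t ↔ PowerSeries.mk c * PowerSeries.mk t =
      (1 - PowerSeries.X) ^ L * PowerSeries.rescale (algebraMap K A q) (PowerSeries.mk t) := by
  rw [PowerSeries.ext_iff]
  refine forall_congr' fun k => ?_
  rw [PowerSeries.coeff_mul, PowerSeries.coeff_mul]
  have h : ∀ i, PowerSeries.coeff i ((1 - PowerSeries.X) ^ L : PowerSeries A) =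
      algebraMap K A (PowerSeries.coeff i ((1 - PowerSeries.X) ^ L : PowerSeries K)) := by
    intro i
    rw [← PowerSeries.coeff_map]
    simp
  have e1 : ∀ ij : ℕ × ℕ, PowerSeries.coeff ij.1 (PowerSeries.mk c) *
      PowerSeries.coeff ij.2 (PowerSeries.mk t) = t ij.2 * c ij.1 := fun ij => by
    rw [PowerSeries.coeff_mk, PowerSeries.coeff_mk, mul_comm]
  have e2 : ∀ ij : ℕ × ℕ, PowerSeries.coeff ij.1 ((1 - PowerSeries.X) ^ L : PowerSeries A) *
      PowerSeries.coeff ij.2 (PowerSeries.rescale (algebraMap K A q) (PowerSeries.mk t)) =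
      (PowerSeries.coeff ij.1 ((1 - PowerSeries.X) ^ L : PowerSeries K) * q ^ ij.2) • t ij.2 :=
    fun ij => by
      rw [h, PowerSeries.coeff_rescale, PowerSeries.coeff_mk, Algebra.smul_def, map_mul,
        map_pow (algebraMap K A), mul_assoc]
  simp only [e1, e2]

/-- Rescaling x to q x is multiplicative, so two q-difference equations can be multiplied. This is
the source of products of the functions F. -/
theorem IsSolution.mul {A : Type*} [CommRing A] [Algebra K A] {L L' : ℕ} {c t c' t' : ℕ → A}
    (h : IsSolution L c t) (h' : IsSolution L' c' t') :
    IsSolution (L + L') (fun k => ∑ ij ∈ antidiagonal k, c ij.1 * c' ij.2)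
      fun k => ∑ ij ∈ antidiagonal k, t ij.1 * t' ij.2 := by
  have key : ∀ f g : ℕ → A, PowerSeries.mk (fun k => ∑ ij ∈ antidiagonal k,
      f ij.1 * g ij.2) = PowerSeries.mk f * PowerSeries.mk g := by
    intro f g
    ext k
    simp [PowerSeries.coeff_mul]
  rw [isSolution_iff_powerSeries] at h h' ⊢
  rw [key, key, map_mul, mul_mul_mul_comm, h, h', pow_add]
  ring

/-! ### The transfer matrices as elements of an incidence algebra -/

instance (L : ℕ) : DecidableEq (BddLen L) := Classical.decEq _

/-- The coefficients of the transfer matrix of one-variable skew polynomials. -/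
def transferElt (L k : ℕ) : IncidenceAlgebra K (BddLen L) where
  toFun mu lam := (oneVar lam.1 mu.1).coeff k
  eq_zero_of_not_le' mu lam h := by rw [oneVar_eq_zero h, Polynomial.coeff_zero]

/-- The coefficients of the dual transfer matrix. -/
def dualElt (L k : ℕ) : IncidenceAlgebra K (BddLen L) where
  toFun mu lam := (dualWeight L (Polynomial.X : Polynomial K) lam.1 mu.1).coeff k
  eq_zero_of_not_le' mu lam h := by rw [dualWeight_eq_zero _ lam.2 mu.2 h, Polynomial.coeff_zero]

theorem transferElt_apply (L k : ℕ) (mu lam : BddLen L) :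
    transferElt L k mu lam = (oneVar lam.1 mu.1).coeff k := rfl

theorem dualElt_apply (L k : ℕ) (mu lam : BddLen L) :
    dualElt L k mu lam = (dualWeight L (Polynomial.X : Polynomial K) lam.1 mu.1).coeff k := rfl

theorem transferElt_zero (L : ℕ) : transferElt L 0 = 1 := by
  ext mu lam _
  rw [transferElt_apply, IncidenceAlgebra.one_apply]
  split_ifs with h
  · rw [h, coeff_zero_oneVar_self]
  · exact coeff_zero_oneVar_of_ne fun h' => h (Subtype.ext h')

open scoped Classical in
theorem dualWeight_zero {L : ℕ} {lam nu : YoungDiagram} (hlam : lam.colLen 0 ≤ L)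
    (hnu : nu.colLen 0 ≤ L) : dualWeight L (0 : K) lam nu = if nu = lam then 1 else 0 := by
  split_ifs with h
  · subst h
    refine Finset.prod_eq_one fun r _ => ?_
    simp [localWeight]
  · have : ∃ r, nu.rowLen r ≠ lam.rowLen r := by
      by_contra h'
      push Not at h'
      exact h (ext_rowLen h')
    obtain ⟨r, hr⟩ := this
    have hrL : r < L := by
      by_contra hrL
      rw [rowLen_eq_zero hlam (not_lt.mp hrL), rowLen_eq_zero hnu (not_lt.mp hrL)] at hr
      exact hr rfl
    refine Finset.prod_eq_zero (Finset.mem_range.mpr hrL) ?_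
    rw [localWeight, if_neg (by omega)]
    split_ifs <;> simp

theorem dualElt_zero (L : ℕ) : dualElt L 0 = 1 := by
  ext mu lam _
  rw [dualElt_apply, IncidenceAlgebra.one_apply, Polynomial.coeff_zero_eq_aeval_zero,
    map_dualWeight, Polynomial.aeval_X, dualWeight_zero lam.2 mu.2]
  classical exact if_congr Subtype.ext_iff.symm rfl rfl

theorem natDegree_dualWeight_le (L : ℕ) (lam nu : YoungDiagram) :
    (dualWeight L (Polynomial.X : Polynomial K) lam nu).natDegree ≤ L := by
  refine (Polynomial.natDegree_prod_le _ _).trans ?_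
  refine (Finset.sum_le_card_nsmul _ _ 1 fun r _ => ?_).trans (by simp)
  simp only [localWeight, Polynomial.algebraMap_eq]
  split_ifs <;> compute_degree <;> exact zero_le_one

theorem dualElt_eq_zero {L k : ℕ} (h : L < k) : dualElt L k = 0 := by
  ext mu lam _
  rw [dualElt_apply, IncidenceAlgebra.zero_apply]
  exact Polynomial.coeff_eq_zero_of_natDegree_lt ((natDegree_dualWeight_le _ _ _).trans_lt h)

/-- The lower bound of the interval may be dropped, since the first factor vanishes on diagrams not
containing `mu`. -/
theorem mul_apply_eq_sum_below {L : ℕ} (a b : IncidenceAlgebra K (BddLen L)) (mu lam : BddLen L)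
    (f g : YoungDiagram → K) (hf : ∀ nu : BddLen L, a mu nu = f nu)
    (hg : ∀ nu : BddLen L, b nu lam = g nu) :
    (a * b) mu lam = ∑ nu ∈ below lam.1, f nu * g nu := by
  classical
  rw [IncidenceAlgebra.mul_apply]
  simp only [hf, hg]
  rw [sum_Icc_bddLen mu lam (fun nu => mu.1 ≤ nu) (fun nu => f nu * g nu) (fun _ _ => Iff.rfl),
    Finset.sum_filter_of_ne]
  intro nu hnu hne
  by_contra h
  refine hne ?_
  have h1 := hf ⟨nu, (colLen_zero_mono (mem_below.mp hnu)).trans lam.2⟩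
  rw [show f nu = 0 from h1.symm.trans (IncidenceAlgebra.apply_eq_zero_of_not_le
    (a := mu) (b := ⟨nu, _⟩) h a), zero_mul]

theorem dualWeight_C_X (L : ℕ) (lam nu : YoungDiagram) :
    dualWeight L (Polynomial.C (Polynomial.X : Polynomial K)) lam nu =
      Polynomial.C (dualWeight L (Polynomial.X : Polynomial K) lam nu) :=
  (map_dualWeight ((Algebra.ofId (Polynomial K) (Polynomial (Polynomial K))).restrictScalars K)
    L Polynomial.X lam nu).symm

theorem dualWeight_X_eq_map (L : ℕ) (lam nu : YoungDiagram) :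
    dualWeight L (Polynomial.X : Polynomial (Polynomial K)) lam nu =
      (dualWeight L (Polynomial.X : Polynomial K) lam nu).map Polynomial.C := by
  have := map_dualWeight (Polynomial.mapAlgHom (Algebra.ofId K (Polynomial K)))
    L Polynomial.X lam nu
  rw [Polynomial.coe_mapAlgHom, Polynomial.map_X] at this
  exact this.symm

theorem dualElt_mul_apply (L i j : ℕ) (mu lam : BddLen L) :
    (dualElt L i * dualElt L j) mu lam = ∑ nu ∈ below lam.1,
      (dualWeight L (Polynomial.X : Polynomial K) nu mu.1).coeff i *
        (dualWeight L (Polynomial.X : Polynomial K) lam.1 nu).coeff j :=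
  mul_apply_eq_sum_below (dualElt L i) (dualElt L j) mu lam
    (fun nu => (dualWeight L (Polynomial.X : Polynomial K) nu mu.1).coeff i)
    (fun nu => (dualWeight L (Polynomial.X : Polynomial K) lam.1 nu).coeff j)
    (fun _ => rfl) fun _ => rfl

theorem dualElt_comm (L i j : ℕ) : dualElt L i * dualElt L j = dualElt L j * dualElt L i := by
  ext mu lam _
  -- The two independent variables are realised in `K[X][X]`, the inner one as x and the outer one
  -- as y; comparing coefficients of x^i y^j gives the claim.
  have h := sum_dualWeight_mul_comm (Polynomial.C (Polynomial.X : Polynomial K)) Polynomial.X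
    lam.2 mu.2
  have h2 := congrArg (fun p => (Polynomial.coeff p j).coeff i) h
  simp only [Polynomial.finsetSum_coeff, dualWeight_C_X, dualWeight_X_eq_map,
    Polynomial.coeff_C_mul, Polynomial.coeff_map, Polynomial.coeff_mul_C] at h2
  rw [dualElt_mul_apply, dualElt_mul_apply]
  simp only [mul_comm (Polynomial.coeff (dualWeight L _ _ mu.1) _)]
  rw [h2]

/-- The linear functional that reads off a matrix element. -/
def entry {L : ℕ} (mu lam : BddLen L) : IncidenceAlgebra K (BddLen L) →ₗ[K] K where
  toFun a := a mu lam
  map_add' _ _ := rfl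
  map_smul' _ _ := rfl

@[simp] theorem entry_apply {L : ℕ} (mu lam : BddLen L) (a : IncidenceAlgebra K (BddLen L)) :
    entry mu lam a = a mu lam := rfl

theorem isSolution_transferElt (L : ℕ) : IsSolution L (dualElt L) (transferElt L) := by
  intro k
  ext mu lam _
  have h := congrArg (fun p : Polynomial K => p.coeff k) (sum_dualWeight_mul_oneVar lam.2 mu.2)
  simp only [Polynomial.finsetSum_coeff, Polynomial.coeff_mul, Polynomial.comp_C_mul_X_coeff] at h
  rw [← entry_apply, ← entry_apply, map_sum, map_sum]
  have e1 : ∀ ij : ℕ × ℕ, entry mu lam (transferElt L ij.2 * dualElt L ij.1) =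
      ∑ nu ∈ below lam.1, (dualWeight L (Polynomial.X : Polynomial K) lam.1 nu).coeff ij.1 *
        (oneVar nu mu.1).coeff ij.2 := by
    intro ij
    rw [entry_apply, mul_apply_eq_sum_below (transferElt L ij.2) (dualElt L ij.1) mu lam
      (fun nu => (oneVar nu mu.1).coeff ij.2)
      (fun nu => (dualWeight L (Polynomial.X : Polynomial K) lam.1 nu).coeff ij.1)
      (fun _ => rfl) fun _ => rfl]
    exact Finset.sum_congr rfl fun _ _ => mul_comm _ _
  have e2 : ∀ ij : ℕ × ℕ, entry mu lam
      ((PowerSeries.coeff ij.1 ((1 - PowerSeries.X) ^ L : PowerSeries K) * q ^ ij.2) •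
        transferElt L ij.2) =
      ((1 - Polynomial.X : Polynomial K) ^ L).coeff ij.1 *
        ((oneVar lam.1 mu.1).coeff ij.2 * q ^ ij.2) := by
    intro ij
    have : ((1 - PowerSeries.X) ^ L : PowerSeries K) =
        (((1 - Polynomial.X : Polynomial K) ^ L : Polynomial K) : PowerSeries K) := by simp
    rw [map_smul, entry_apply, transferElt_apply, smul_eq_mul, this, Polynomial.coeff_coe]
    ring
  rw [Finset.sum_congr rfl fun ij _ => e1 ij, Finset.sum_congr rfl fun ij _ => e2 ij,
    Finset.sum_comm]
  exact h

/-! ### The skew functions as matrix elements of a representation of a polynomial ring -/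

/-- The representation of the polynomial ring by the coefficients of the dual transfer matrix. -/
def rho (L : ℕ) : MvPolynomial (Fin L) K →ₐ[K] IncidenceAlgebra K (BddLen L) :=
  (exists_mvPolynomial_algHom (fun r : Fin L => dualElt L (r + 1))
    fun i j => dualElt_comm L (i + 1) (j + 1)).choose

theorem rho_X (L : ℕ) (r : Fin L) : rho L (MvPolynomial.X r) = dualElt L (r + 1) :=
  (exists_mvPolynomial_algHom (fun r : Fin L => dualElt L (r + 1))
    fun i j => dualElt_comm L (i + 1) (j + 1)).choose_spec r

/-- The coefficients of the generic polynomial of degree `L` with constant term `1`. -/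
def genericCoeff (L : ℕ) : ℕ → MvPolynomial (Fin L) K
  | 0 => 1
  | k + 1 => if h : k < L then MvPolynomial.X ⟨k, h⟩ else 0

theorem rho_genericCoeff (L k : ℕ) : rho L (genericCoeff L k) = dualElt L k := by
  obtain _ | k := k
  · rw [genericCoeff, map_one, dualElt_zero]
  · rw [genericCoeff]
    split_ifs with h
    · exact rho_X L ⟨k, h⟩
    · rw [map_zero, dualElt_eq_zero (by omega)]

theorem aeval_genericCoeff {R : Type*} [CommRing R] [Algebra K R] {L : ℕ} {c : ℕ → R}
    (h0 : c 0 = 1) (hL : ∀ k, L < k → c k = 0) (k : ℕ) :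
    MvPolynomial.aeval (fun r : Fin L => c (r + 1)) (genericCoeff L k) = c k := by
  obtain _ | k := k
  · rw [genericCoeff, map_one, h0]
  · rw [genericCoeff]
    split_ifs with h
    · rw [MvPolynomial.aeval_X]
    · rw [map_zero, hL _ (by omega)]

/-- The universal solution of the `q`-difference equation. -/
def genericSolution (L : ℕ) : ℕ → MvPolynomial (Fin L) K := solution L (genericCoeff L)

theorem genericSolution_zero (L : ℕ) : genericSolution L 0 = 1 := by
  rw [genericSolution, solution]

theorem isSolution_genericSolution (L : ℕ) : IsSolution L (genericCoeff L) (genericSolution L) :=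
  isSolution_solution L _ rfl

/-- Both sides solve the same q-difference equation with initial value 1. Thus the coefficients of T
are polynomials in those of D, and in particular commute. -/
theorem rho_genericSolution (L k : ℕ) : rho L (genericSolution L k) = transferElt L k := by
  have h1 := (isSolution_genericSolution L).map (rho L)
  simp only [rho_genericCoeff] at h1
  exact h1.unique (dualElt_zero L)
    (by rw [genericSolution_zero, map_one, transferElt_zero]) (isSolution_transferElt L) k

theorem aeval_genericSolution {R : Type*} [CommRing R] [Algebra K R] {L : ℕ} {c t : ℕ → R}
    (h0 : c 0 = 1) (hL : ∀ k, L < k → c k = 0) (ht0 : t 0 = 1) (h : IsSolution L c t) (k : ℕ) :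
    MvPolynomial.aeval (fun r : Fin L => c (r + 1)) (genericSolution L k) = t k := by
  have h1 := (isSolution_genericSolution L).map (MvPolynomial.aeval fun r : Fin L => c (r + 1))
  simp only [aeval_genericCoeff h0 hL] at h1
  exact h1.unique h0 (by rw [genericSolution_zero, map_one, ht0]) h k

theorem coeff_mul_aeval_X_of_forall (p : MvPolynomial ℕ K) (r : Polynomial K) (n : ℕ)
    (hp : ∀ d : ℕ →₀ ℕ, d n ≠ 0 → MvPolynomial.coeff d p = 0) (d : ℕ →₀ ℕ) :
    MvPolynomial.coeff d (p * Polynomial.aeval (MvPolynomial.X n) r) =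
      MvPolynomial.coeff (d.erase n) p * r.coeff (d n) := by
  induction r using Polynomial.induction_on' with
  | add r s hr hs => rw [map_add, mul_add, MvPolynomial.coeff_add, hr, hs, Polynomial.coeff_add,
      mul_add]
  | monomial k a =>
    have h1 : Polynomial.aeval (MvPolynomial.X n : MvPolynomial ℕ K) (Polynomial.monomial k a) =
        MvPolynomial.monomial (Finsupp.single n k) a := by
      rw [Polynomial.aeval_monomial, MvPolynomial.algebraMap_eq,
        MvPolynomial.C_mul_X_pow_eq_monomial]
    rw [h1, MvPolynomial.coeff_mul_monomial', Polynomial.coeff_monomial]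
    rcases lt_trichotomy k (d n) with h | h | h
    · rw [if_neg h.ne, mul_zero, hp, zero_mul, ite_self]
      rw [Finsupp.tsub_apply, Finsupp.single_eq_same]
      omega
    · rw [if_pos h, h, if_pos]
      · congr 2
        ext i
        rw [Finsupp.tsub_apply, Finsupp.erase_apply, Finsupp.single_apply]
        split_ifs <;> first | omega | (subst_vars; simp at *)
      · rw [Finsupp.single_le_iff]
    · rw [if_neg h.ne', mul_zero, if_neg]
      rw [Finsupp.single_le_iff]
      omega

/-- Branching is multiplication in the incidence algebra: the variable x_n contributes the right
factor T_{d n}. The first half, that only variables below n occur, is what allows the coefficient of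
x_n to be separated in the induction. -/
theorem coeff_skewPoly {L : ℕ} (n : ℕ) (lam mu : BddLen L) (d : ℕ →₀ ℕ) :
    ((∃ i, n ≤ i ∧ d i ≠ 0) → MvPolynomial.coeff d (skewPoly n lam.1 mu.1) = 0) ∧
    ((∀ i, n ≤ i → d i = 0) → MvPolynomial.coeff d (skewPoly n lam.1 mu.1) =
      rho L (∏ i ∈ Finset.range n, genericSolution L (d i)) mu lam) := by
  classical
  induction n generalizing lam d with
  | zero =>
    rw [skewPoly, Finset.range_zero, Finset.prod_empty, map_one, IncidenceAlgebra.one_apply]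
    constructor
    · rintro ⟨i, _, hi⟩
      split_ifs with h
      · rw [MvPolynomial.coeff_one, if_neg]
        rintro rfl
        exact hi rfl
      · exact MvPolynomial.coeff_zero d
    · intro h
      have hd : d = 0 := Finsupp.ext fun i => h i (Nat.zero_le i)
      subst hd
      split_ifs with h1 h2 h2
      · exact MvPolynomial.coeff_zero_one
      · exact absurd (Subtype.ext h1.symm) h2
      · exact absurd (congrArg Subtype.val h2.symm) h1
      · exact MvPolynomial.coeff_zero 0
  | succ n ih =>
    have hcoeff : MvPolynomial.coeff d (skewPoly (n + 1) lam.1 mu.1) = ∑ nu ∈ below lam.1,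
        MvPolynomial.coeff (d.erase n) (skewPoly n nu mu.1) * (oneVar lam.1 nu).coeff (d n) := by
      rw [skewPoly, MvPolynomial.coeff_sum]
      have h1 : ∀ nu ∈ (below lam.1).filter (fun nu => mu.1 ≤ nu ∧ HorizontalStrip nu lam.1),
          MvPolynomial.coeff d (skewPoly n nu mu.1 *
            Polynomial.aeval (MvPolynomial.X n) (oneVar lam.1 nu)) =
          MvPolynomial.coeff (d.erase n) (skewPoly n nu mu.1) * (oneVar lam.1 nu).coeff (d n) := by
        intro nu hnu
        rw [Finset.mem_filter, mem_below] at hnu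
        refine coeff_mul_aeval_X_of_forall _ _ _ (fun e he => ?_) d
        exact (ih ⟨nu, (colLen_zero_mono hnu.1).trans lam.2⟩ e).1 ⟨n, le_rfl, he⟩
      rw [Finset.sum_congr rfl h1, Finset.sum_filter_of_ne]
      intro nu _ hne
      constructor
      · by_contra h
        rw [skewPoly_eq_zero h, MvPolynomial.coeff_zero, zero_mul] at hne
        exact hne rfl
      · by_contra h
        rw [oneVar, if_neg h, Polynomial.coeff_zero, mul_zero] at hne
        exact hne rfl
    rw [hcoeff]
    constructor
    · rintro ⟨i, hi, hdi⟩
      refine Finset.sum_eq_zero fun nu hnu => ?_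
      have := (ih ⟨nu, (colLen_zero_mono (mem_below.mp hnu)).trans lam.2⟩ (d.erase n)).1
        ⟨i, by omega, by rwa [Finsupp.erase_ne (by omega)]⟩
      rw [this, zero_mul]
    · intro hd
      have hd' : ∀ i, n ≤ i → (d.erase n) i = 0 := by
        intro i hi
        rcases eq_or_ne i n with rfl | hne
        · exact Finsupp.erase_same
        · rw [Finsupp.erase_ne hne]
          exact hd i (by omega)
      have hprod : ∏ i ∈ Finset.range n, genericSolution L (d i) =
          ∏ i ∈ Finset.range n, genericSolution L (d.erase n i) := by
        refine Finset.prod_congr rfl fun i hi => ?_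
        rw [Finsupp.erase_ne (Finset.mem_range.mp hi).ne]
      rw [Finset.prod_range_succ, map_mul, rho_genericSolution, hprod]
      exact (mul_apply_eq_sum_below (rho L (∏ i ∈ Finset.range n, genericSolution L (d.erase n i)))
        (transferElt L (d n)) mu lam
        (fun nu => MvPolynomial.coeff (d.erase n) (skewPoly n nu mu.1))
        (fun nu => (oneVar lam.1 nu).coeff (d n)) (fun nu => ((ih nu (d.erase n)).2 hd').symm)
        fun _ => rfl).symm

/-- The element of the polynomial ring whose matrix elements are the coefficients of the
monomial `d` in the skew functions. -/
def monomialElt (L : ℕ) (d : ℕ →₀ ℕ) : MvPolynomial (Fin L) K :=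
  d.prod fun _ k => genericSolution L k

theorem monomialElt_eq_prod {L : ℕ} {d : ℕ →₀ ℕ} {s : Finset ℕ} (hs : ∀ i, i ∉ s → d i = 0) :
    monomialElt L d = ∏ i ∈ s, genericSolution L (d i) := by
  refine Finset.prod_subset (fun i hi => ?_) fun i _ hi => ?_
  · by_contra h
    exact (Finsupp.mem_support_iff.mp hi) (hs i h)
  · rw [Finsupp.notMem_support_iff.mp hi]
    exact genericSolution_zero L

theorem coeff_skewF_eq {L : ℕ} (lam mu : BddLen L) (d : ℕ →₀ ℕ) :
    MvPowerSeries.coeff d (skewF lam.1 mu.1) = rho L (monomialElt L d) mu lam := by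
  obtain ⟨n, hn⟩ : ∃ n, ∀ i, n ≤ i → d i = 0 := by
    refine ⟨d.support.sup id + 1, fun i hi => ?_⟩
    by_contra h
    have := Finset.le_sup (f := id) (Finsupp.mem_support_iff.mpr h)
    simp only [id] at this
    omega
  rw [coeff_skewF _ _ d n hn, (coeff_skewPoly n lam mu d).2 hn, monomialElt_eq_prod]
  exact fun i hi => hn i (by simpa using hi)

/-! ### Symmetry and degree bounds. -/

theorem monomialElt_mapDomain (L : ℕ) (e : ℕ → ℕ) (he : Function.Injective e) (d : ℕ →₀ ℕ) :
    monomialElt L (d.mapDomain e) = monomialElt L d :=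
  Finsupp.prod_mapDomain_index_inj he

theorem monomialElt_add {L : ℕ} {d e : ℕ →₀ ℕ} (h : Disjoint d.support e.support) :
    monomialElt L (d + e) = monomialElt L d * monomialElt L e :=
  Finsupp.prod_add_index_of_disjoint h _

theorem skewF_mem_LamHat (lam mu : YoungDiagram) : skewF lam mu ∈ LamHat := by
  rw [mem_LamHat_iff_coeff]
  intro e d
  have h1 := coeff_skewF_eq (L := max (lam.colLen 0) (mu.colLen 0)) ⟨lam, le_max_left _ _⟩
    ⟨mu, le_max_right _ _⟩
  rw [h1, h1, monomialElt_mapDomain _ _ e.injective]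

theorem natDegree_rowWeight_le (a b : ℤ) : (rowWeight a b).natDegree ≤ (a + b).toNat := by
  rw [rowWeight]
  split_ifs with h
  · have h1 : (qPoch Polynomial.X (Polynomial.C q) b.toNat : Polynomial K).natDegree ≤ b.toNat := by
      refine (Polynomial.natDegree_prod_le _ _).trans ?_
      refine (Finset.sum_le_card_nsmul _ _ 1 fun r _ => ?_).trans (by simp)
      simp only [← Polynomial.C_pow]
      compute_degree
    refine Polynomial.natDegree_mul_le.trans ?_
    refine (add_le_add (Polynomial.natDegree_X_pow_le _)
      ((Polynomial.natDegree_mul_C_le _ _).trans h1)).trans ?_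
    omega
  · simp

/-- The row weight has degree at most λ_r - λ_{r+1}, whatever `mu` is, and these bounds telescope to
the first row. -/
theorem natDegree_oneVar_le (lam mu : YoungDiagram) :
    (oneVar lam mu).natDegree ≤ lam.rowLen 0 := by
  by_cases h : mu ≤ lam
  · have hmu := colLen_zero_mono h
    rw [oneVar_eq_prod le_rfl hmu]
    refine (Polynomial.natDegree_prod_le _ _).trans ?_
    refine (Finset.sum_le_sum fun r _ => natDegree_rowWeight_le _ _).trans ?_
    have h1 : ∀ r, ((lam.rowLen r : ℤ) - mu.rowLen r + (mu.rowLen r - lam.rowLen (r + 1))).toNat =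
        lam.rowLen r - lam.rowLen (r + 1) := fun r => by omega
    simp only [h1]
    have := sum_sub_rowLen lam (lam.colLen 0)
    omega
  · rw [oneVar_eq_zero h]
    simp

theorem coeff_oneVar_eq_zero {lam mu : YoungDiagram} {k : ℕ} (h : mu.card + k < lam.card) :
    (oneVar lam mu).coeff k = 0 := by
  rw [oneVar]
  split_ifs
  · rw [Polynomial.coeff_X_pow_mul', if_neg (by omega)]
  · exact Polynomial.coeff_zero k

/-- By commutativity the factor of x_i can be moved to the front, where it is the coefficient of
x^(d i) in a one-variable polynomial for some ν ≤ λ, of degree at most ν_1 ≤ λ_1. -/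
theorem coeff_skewF_eq_zero_of_lt {lam mu : YoungDiagram} {d : ℕ →₀ ℕ} {i : ℕ}
    (h : lam.rowLen 0 < d i) : MvPowerSeries.coeff d (skewF lam mu) = 0 := by
  rw [coeff_skewF_eq (L := max (lam.colLen 0) (mu.colLen 0)) ⟨lam, le_max_left _ _⟩
    ⟨mu, le_max_right _ _⟩]
  have h1 : d = Finsupp.single i (d i) + d.erase i := (Finsupp.single_add_erase i d).symm
  rw [h1, monomialElt_add]
  · rw [map_mul, monomialElt,
      Finsupp.prod_single_index (h := fun _ k => genericSolution _ k) (genericSolution_zero _),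
      rho_genericSolution, IncidenceAlgebra.mul_apply]
    refine Finset.sum_eq_zero fun nu hnu => ?_
    have h2 := le_iff_rowLen.mp (Finset.mem_Icc.mp hnu).2 0
    rw [transferElt_apply, Polynomial.coeff_eq_zero_of_natDegree_lt, zero_mul]
    exact (natDegree_oneVar_le _ _).trans_lt (lt_of_le_of_lt h2 h)
  · rw [Finsupp.support_erase]
    exact Finset.disjoint_of_subset_left Finsupp.support_single_subset (by simp)

theorem rho_prod_apply_eq_zero {L : ℕ} (s : Finset ℕ) (d : ℕ → ℕ) (lam mu : BddLen L)
    (h : mu.1.card + ∑ i ∈ s, d i < lam.1.card) :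
    rho L (∏ i ∈ s, genericSolution L (d i)) mu lam = 0 := by
  classical
  induction s using Finset.induction_on generalizing lam with
  | empty =>
    rw [Finset.prod_empty, map_one, IncidenceAlgebra.one_apply, if_neg]
    rintro rfl
    simp at h
  | insert i s hi ih =>
    rw [Finset.sum_insert hi] at h
    rw [Finset.prod_insert hi, mul_comm, map_mul, rho_genericSolution, IncidenceAlgebra.mul_apply]
    refine Finset.sum_eq_zero fun nu _ => ?_
    by_cases hnu : mu.1.card + ∑ i ∈ s, d i < nu.1.card
    · rw [ih nu hnu, zero_mul]
    · rw [transferElt_apply, coeff_oneVar_eq_zero (by omega), mul_zero]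

theorem coeff_skewF_eq_zero_of_degree_lt {lam mu : YoungDiagram} {d : ℕ →₀ ℕ}
    (h : mu.card + d.degree < lam.card) : MvPowerSeries.coeff d (skewF lam mu) = 0 := by
  rw [coeff_skewF_eq (L := max (lam.colLen 0) (mu.colLen 0)) ⟨lam, le_max_left _ _⟩
    ⟨mu, le_max_right _ _⟩, monomialElt_eq_prod fun i hi => Finsupp.notMem_support_iff.mp hi]
  exact rho_prod_apply_eq_zero _ _ _ _ h

/-! ### Triangularity of the monomial coefficients -/

/-- Partitions are compared by size first, then by the value of a statistic. -/
def orderKey (s : YoungDiagram → ℕ) (lam : YoungDiagram) : ℕ ×ₗ ℕ := toLex (lam.card, s lam)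

theorem orderKey_lt_iff {s : YoungDiagram → ℕ} {mu lam : YoungDiagram} :
    orderKey s mu < orderKey s lam ↔
      mu.card < lam.card ∨ mu.card = lam.card ∧ s mu < s lam :=
  Prod.Lex.toLex_lt_toLex

/-- The statistic `∑ i λ_i`. -/
def rowStat (lam : YoungDiagram) : ℕ := ∑ r ∈ Finset.range (lam.colLen 0), r * lam.rowLen r

theorem rowStat_eq_sum {lam : YoungDiagram} {L : ℕ} (h : lam.colLen 0 ≤ L) :
    rowStat lam = ∑ r ∈ Finset.range L, r * lam.rowLen r := by
  refine Finset.sum_subset (Finset.range_mono h) fun r _ hr => ?_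
  rw [rowLen_eq_zero le_rfl (not_lt.mp (mt Finset.mem_range.mpr hr)), mul_zero]

/-- The partition obtained by removing the first row. -/
def removeRow (lam : YoungDiagram) : YoungDiagram :=
  ofFun (fun r => lam.rowLen (r + 1)) (fun _ _ h => lam.rowLen_anti _ _ (Nat.succ_le_succ h))
    (lam.colLen 0) (rowLen_eq_zero le_rfl (Nat.le_succ _))

@[simp] theorem rowLen_removeRow (lam : YoungDiagram) (r : ℕ) :
    (removeRow lam).rowLen r = lam.rowLen (r + 1) := rowLen_ofFun _ _ _ _ _

theorem colLen_removeRow_le {lam : YoungDiagram} {L : ℕ} (h : lam.colLen 0 ≤ L + 1) :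
    (removeRow lam).colLen 0 ≤ L := by
  rw [colLen_zero_le_iff, rowLen_removeRow]
  exact rowLen_eq_zero h le_rfl

theorem removeRow_le (lam : YoungDiagram) : removeRow lam ≤ lam :=
  le_iff_rowLen.mpr fun r => by
    rw [rowLen_removeRow]
    exact rowLen_succ_le lam r

theorem card_removeRow (lam : YoungDiagram) : (removeRow lam).card + lam.rowLen 0 = lam.card := by
  rw [card_eq_sum (L := lam.colLen 0 + 1) (Nat.le_succ _), Finset.sum_range_succ',
    card_eq_sum (colLen_removeRow_le (Nat.le_succ _))]
  simp

theorem rowStat_removeRow (lam : YoungDiagram) :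
    rowStat lam = rowStat (removeRow lam) + (removeRow lam).card := by
  have h := colLen_removeRow_le (Nat.le_succ (lam.colLen 0))
  rw [rowStat_eq_sum (L := lam.colLen 0 + 1) (Nat.le_succ _), Finset.sum_range_succ', zero_mul,
    add_zero, rowStat_eq_sum h, card_eq_sum h, ← Finset.sum_add_distrib]
  refine Finset.sum_congr rfl fun r _ => ?_
  rw [rowLen_removeRow]
  ring

/-- Interlacing bounds row r + 1 of `mu` by row r of `nu`; summing with weight r + 1 gives the
inequality, and equality makes every one of these bounds sharp. -/
theorem rowStat_le {mu nu : YoungDiagram} (h : HorizontalStrip nu mu) :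
    rowStat mu ≤ rowStat nu + nu.card ∧
      (rowStat mu = rowStat nu + nu.card → removeRow mu = nu) := by
  rw [horizontalStrip_iff] at h
  have hnu : nu.colLen 0 ≤ mu.colLen 0 :=
    colLen_zero_mono (le_iff_rowLen.mpr fun r => (h r).2)
  rw [rowStat_eq_sum (L := mu.colLen 0 + 1) (Nat.le_succ _), Finset.sum_range_succ', zero_mul,
    add_zero, rowStat_eq_sum hnu, card_eq_sum hnu, ← Finset.sum_add_distrib]
  have hle : ∀ r ∈ Finset.range (mu.colLen 0),
      (r + 1) * mu.rowLen (r + 1) ≤ r * nu.rowLen r + nu.rowLen r := fun r _ =>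
    (Nat.mul_le_mul_left (r + 1) (h r).1).trans (by rw [add_mul, one_mul])
  refine ⟨Finset.sum_le_sum hle, fun heq => ext_rowLen fun r => ?_⟩
  rw [rowLen_removeRow]
  by_cases hr : r < mu.colLen 0
  · have h1 := (Finset.sum_eq_sum_iff_of_le hle).mp heq r (Finset.mem_range.mpr hr)
    have h2 : (r + 1) * mu.rowLen (r + 1) = (r + 1) * nu.rowLen r := by rw [h1]; ring
    exact Nat.eq_of_mul_eq_mul_left (Nat.succ_pos r) h2
  · rw [rowLen_eq_zero hnu (not_lt.mp hr),
      rowLen_eq_zero le_rfl (show mu.colLen 0 ≤ r + 1 by omega)]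

theorem oneVar_removeRow (lam : YoungDiagram) :
    oneVar lam (removeRow lam) = Polynomial.X ^ lam.rowLen 0 := by
  rw [oneVar_eq_prod le_rfl (colLen_removeRow_le (Nat.le_succ _))]
  have h : ∀ r, rowWeight ((lam.rowLen r : ℤ) - (removeRow lam).rowLen r)
      (((removeRow lam).rowLen r : ℤ) - lam.rowLen (r + 1)) =
      Polynomial.X ^ (lam.rowLen r - lam.rowLen (r + 1)) := by
    intro r
    have h1 := rowWeight_natCast (lam.rowLen r - lam.rowLen (r + 1)) 0
    rw [Nat.cast_sub (rowLen_succ_le lam r)] at h1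
    rw [rowLen_removeRow, sub_self]
    simpa using h1
  rw [Finset.prod_congr rfl fun r _ => h r, Finset.prod_pow_eq_pow_sum]
  have h2 := sum_sub_rowLen lam (lam.colLen 0)
  rw [rowLen_eq_zero le_rfl le_rfl, add_zero] at h2
  rw [h2]

instance (L : ℕ) : OrderBot (BddLen L) where
  bot := ⟨⊥, by simp⟩
  bot_le a := bot_le (a := a.1)

@[simp] theorem coe_bot_bddLen (L : ℕ) : ((⊥ : BddLen L) : YoungDiagram) = ⊥ := rfl

/-- T_k adds a horizontal strip of at most k boxes, so the size is at most |λ|. At equal size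
`rowStat_le` bounds the statistic, and equality at every step means that each new strip becomes the
whole first row and pushes the old rows down, which builds λ. -/
theorem rho_rowLen_prod {L : ℕ} (n : ℕ) (lam : BddLen L) (hn : lam.1.colLen 0 ≤ n) :
    (∀ mu : BddLen L, rho L (∏ i ∈ Finset.range n, genericSolution L (lam.1.rowLen i)) ⊥ mu ≠ 0 →
      orderKey rowStat mu.1 < orderKey rowStat lam.1 ∨ mu = lam) ∧
    rho L (∏ i ∈ Finset.range n, genericSolution L (lam.1.rowLen i)) ⊥ lam = 1 := by
  induction n generalizing lam with
  | zero =>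
    have hlam : lam = ⊥ := Subtype.ext <| ext_rowLen fun r => by
      rw [rowLen_eq_zero hn (Nat.zero_le r)]
      simp
    rw [Finset.range_zero, Finset.prod_empty, map_one]
    constructor
    · intro mu h
      rw [IncidenceAlgebra.one_apply] at h
      right
      rw [hlam]
      by_contra h'
      exact h (if_neg fun h2 => h' h2.symm)
    · rw [hlam, IncidenceAlgebra.one_apply, if_pos rfl]
  | succ n ih =>
    let lam' : BddLen L := ⟨removeRow lam.1, (colLen_zero_mono (removeRow_le _)).trans lam.2⟩
    -- The largest part is moved to the last step, so that the induction removes the first row.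
    have hprod : ∏ i ∈ Finset.range (n + 1), genericSolution L (lam.1.rowLen i) =
        (∏ i ∈ Finset.range n, genericSolution L (lam'.1.rowLen i)) *
          genericSolution L (lam.1.rowLen 0) := by
      rw [Finset.prod_range_succ']
      simp only [lam', rowLen_removeRow]
    obtain ⟨ih1, ih2⟩ := ih lam' (colLen_removeRow_le hn)
    have hc := card_removeRow lam.1
    have hs := rowStat_removeRow lam.1
    have key : ∀ mu nu : BddLen L,
        rho L (∏ i ∈ Finset.range n, genericSolution L (lam'.1.rowLen i)) ⊥ nu *
          transferElt L (lam.1.rowLen 0) nu mu ≠ 0 →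
        orderKey rowStat mu.1 < orderKey rowStat lam.1 ∨ (mu = lam ∧ nu = lam') := by
      intro mu nu h
      have h1 := ih1 nu (left_ne_zero_of_mul h)
      have h2 := right_ne_zero_of_mul h
      rw [transferElt_apply] at h2
      have h3 : mu.1.card ≤ nu.1.card + lam.1.rowLen 0 := by
        by_contra h'
        exact h2 (coeff_oneVar_eq_zero (not_le.mp h'))
      have h4 : HorizontalStrip nu.1 mu.1 := by
        by_contra h'
        exact h2 (by rw [oneVar, if_neg h', Polynomial.coeff_zero])
      obtain ⟨h5, h6⟩ := rowStat_le h4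
      rw [orderKey_lt_iff] at h1 ⊢
      rcases h1 with (h1 | ⟨h1, h1'⟩) | h1
      · left; left
        simp only [lam'] at h1
        omega
      · left
        simp only [lam'] at h1 h1'
        omega
      · subst h1
        simp only [lam'] at h3 h5 h6
        by_cases h7 : rowStat mu.1 = rowStat (removeRow lam.1) + (removeRow lam.1).card ∧
            mu.1.card = lam.1.card
        · right
          refine ⟨Subtype.ext (ext_rowLen fun r => ?_), rfl⟩
          have h8 := h6 h7.1
          obtain _ | r := r
          · have := card_removeRow mu.1
            rw [h8] at this
            omega
          · rw [← rowLen_removeRow, h8, rowLen_removeRow]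
        · left
          omega
    rw [hprod, map_mul, rho_genericSolution]
    constructor
    · intro mu h
      rw [IncidenceAlgebra.mul_apply] at h
      obtain ⟨nu, _, hnu⟩ := Finset.exists_ne_zero_of_sum_ne_zero h
      exact (key mu nu hnu).imp_right And.left
    · rw [IncidenceAlgebra.mul_apply, Finset.sum_eq_single lam']
      · rw [ih2, one_mul, transferElt_apply, oneVar_removeRow, Polynomial.coeff_X_pow, if_pos rfl]
      · intro nu _ hne
        by_contra h
        rcases key lam nu h with h1 | h1
        · exact lt_irrefl _ h1
        · exact hne h1.2
      · intro h
        have h1 : lam' ≤ lam := removeRow_le lam.1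
        exact absurd (Finset.mem_Icc.mpr ⟨bot_le, h1⟩) h

/-- The exponent vector of the monomial `∏ x_i ^ λ_i`. -/
def rowMonomial (lam : YoungDiagram) : ℕ →₀ ℕ :=
  Finsupp.onFinset (Finset.range (lam.colLen 0)) lam.rowLen fun r hr => by
    rw [Finset.mem_range]
    by_contra h
    exact hr (rowLen_eq_zero le_rfl (not_lt.mp h))

@[simp] theorem rowMonomial_apply (lam : YoungDiagram) (r : ℕ) :
    rowMonomial lam r = lam.rowLen r := rfl

theorem coeff_rowMonomial_F (lam mu : YoungDiagram) :
    (MvPowerSeries.coeff (rowMonomial lam) (F mu) ≠ 0 →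
      orderKey rowStat mu < orderKey rowStat lam ∨ mu = lam) ∧
    MvPowerSeries.coeff (rowMonomial lam) (F lam) = 1 := by
  let L := max (lam.colLen 0) (mu.colLen 0)
  let lam' : BddLen L := ⟨lam, le_max_left _ _⟩
  let mu' : BddLen L := ⟨mu, le_max_right _ _⟩
  obtain ⟨h1, h2⟩ := rho_rowLen_prod L lam' lam'.2
  have h3 : ∀ nu : BddLen L, MvPowerSeries.coeff (rowMonomial lam) (F nu) =
      rho L (∏ i ∈ Finset.range L, genericSolution L (lam'.1.rowLen i)) ⊥ nu := by
    intro nu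
    rw [F, ← coe_bot_bddLen L, coeff_skewF_eq, monomialElt_eq_prod (s := Finset.range L)]
    · rfl
    · intro i hi
      exact rowLen_eq_zero lam'.2 (by simpa using hi)
  refine ⟨fun h => ?_, (h3 lam').trans h2⟩
  exact (h1 mu' (by rwa [← h3 mu'])).imp_right fun h => congrArg Subtype.val h

/-! ### Uniqueness and support of expansions. -/

theorem finite_coeff_F_ne_zero (d : ℕ →₀ ℕ) :
    {lam | MvPowerSeries.coeff d (F lam) ≠ 0}.Finite := by
  refine (finite_card_le d.degree).subset fun lam h => ?_
  by_contra h'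
  exact h (coeff_skewF_eq_zero_of_degree_lt (by simpa using h'))

theorem finite_support_mul_coeff_F (c : YoungDiagram → K) (d : ℕ →₀ ℕ) :
    (Function.support fun lam => c lam * MvPowerSeries.coeff d (F lam)).Finite :=
  (finite_coeff_F_ne_zero d).subset fun _ h => right_ne_zero_of_mul h

/-- Choose λ of minimal key in the support of `c`: any other F_μ containing x^λ has a smaller key,
hence coefficient zero. -/
theorem exists_leading_coeff {c : YoungDiagram → K} (hc : c ≠ 0) : ∃ lam, c lam ≠ 0 ∧
    ∑ᶠ mu, c mu * MvPowerSeries.coeff (rowMonomial lam) (F mu) = c lam := by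
  obtain ⟨lam0, h0⟩ := Function.ne_iff.mp hc
  obtain ⟨lam, hlam, hmin⟩ := (InvImage.wf (orderKey rowStat) wellFounded_lt).has_min
    {lam | c lam ≠ 0} ⟨lam0, h0⟩
  refine ⟨lam, hlam, ?_⟩
  rw [finsum_eq_single _ lam, (coeff_rowMonomial_F lam lam).2, mul_one]
  intro mu hmu
  by_contra h
  rcases (coeff_rowMonomial_F lam mu).1 (right_ne_zero_of_mul h) with h1 | h1
  · exact hmin mu (left_ne_zero_of_mul h) h1
  · exact hmu h1

theorem IsExpansion.unique {f : MvPowerSeries ℕ K} {c c' : YoungDiagram → K}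
    (h : IsExpansion f c) (h' : IsExpansion f c') : c = c' := by
  by_contra hne
  obtain ⟨lam, h1, h2⟩ := exists_leading_coeff (sub_ne_zero.mpr hne)
  refine h1 (h2.symm.trans ?_)
  simp only [Pi.sub_apply, sub_mul]
  rw [finsum_sub_distrib (finite_support_mul_coeff_F _ _) (finite_support_mul_coeff_F _ _),
    ← h, ← h',
    sub_self]

/-- Truncate `c` to the partitions with first row longer than N and take a leading κ. The discarded
F_μ have degree at most N in x_0, so they do not contain x^κ; thus the coefficient of x^κ in f would
be c κ ≠ 0. -/
theorem IsExpansion.eq_zero_of_lt {f : MvPowerSeries ℕ K} {c : YoungDiagram → K}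
    (h : IsExpansion f c) {N : ℕ} (hN : ∀ d : ℕ →₀ ℕ, N < d 0 → MvPowerSeries.coeff d f = 0)
    {lam : YoungDiagram} (hlam : N < lam.rowLen 0) : c lam = 0 := by
  by_contra hne
  have hc : (fun mu : YoungDiagram => if N < mu.rowLen 0 then c mu else 0) ≠ 0 :=
    Function.ne_iff.mpr ⟨lam, by simpa [hlam] using hne⟩
  obtain ⟨ka, h1, h2⟩ := exists_leading_coeff hc
  have h3 : N < ka.rowLen 0 := by
    by_contra h3
    exact h1 (if_neg h3)
  rw [if_pos h3] at h1 h2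
  refine h1 (h2.symm.trans (Eq.trans ?_ ((h (rowMonomial ka)).symm.trans (hN _ h3))))
  refine finsum_congr fun mu => ?_
  split_ifs with h4
  · rfl
  · rw [F, coeff_skewF_eq_zero_of_lt (i := 0), mul_zero, mul_zero]
    rw [rowMonomial_apply]
    omega

/-! ### Faithfulness of the vacuum functional -/

/-- The local weights of the dual transfer matrix without their powers of the variable. -/
def reducedWeight {R : Type*} [CommRing R] (x Q : R) (a b : ℤ) : R :=
  if a = 0 then (if b = 0 then 1 - Q * x else if b = 1 then 1 else 0)
  else if a = 1 then (if b = 0 then -(1 - Q) else if b = 1 then -1 else 0)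
  else 0

theorem localWeight_eq_pow_mul {R : Type*} [CommRing R] (x Q : R) (a b : ℤ) :
    localWeight x Q a b = x ^ a.toNat * reducedWeight x Q a b := by
  rw [localWeight, reducedWeight]
  split_ifs <;> subst_vars <;> simp
  ring

theorem dualWeight_eq_pow_mul {L : ℕ} {lam nu : YoungDiagram} (h : nu ≤ lam)
    (hlam : lam.colLen 0 ≤ L) :
    dualWeight L (Polynomial.X : Polynomial K) lam nu =
      Polynomial.X ^ (lam.card - nu.card) * ∏ r ∈ Finset.range L, reducedWeight Polynomial.X
        (Polynomial.C (q ^ ((lam.rowLen r : ℤ) - lam.rowLen (r + 1))))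
        ((lam.rowLen r : ℤ) - nu.rowLen r) ((lam.rowLen (r + 1) : ℤ) - nu.rowLen (r + 1)) := by
  have hle := le_iff_rowLen.mp h
  have hcard : lam.card - nu.card = ∑ r ∈ Finset.range L, (lam.rowLen r - nu.rowLen r) := by
    rw [card_eq_sum hlam, card_eq_sum ((colLen_zero_mono h).trans hlam),
      ← Finset.sum_tsub_distrib _ fun r _ => hle r]
  rw [hcard, ← Finset.prod_pow_eq_pow_sum, ← Finset.prod_mul_distrib, dualWeight]
  refine Finset.prod_congr rfl fun r _ => ?_
  rw [localWeight_eq_pow_mul, Polynomial.algebraMap_eq]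
  congr 2
  have := hle r
  omega

theorem coeff_dualWeight_ne_zero {L k : ℕ} {lam nu : YoungDiagram}
    (hlam : lam.colLen 0 ≤ L) (hnu : nu.colLen 0 ≤ L)
    (hne : (dualWeight L (Polynomial.X : Polynomial K) lam nu).coeff k ≠ 0) :
    (∀ r, nu.rowLen r ≤ lam.rowLen r ∧ lam.rowLen r ≤ nu.rowLen r + 1) ∧
      lam.card ≤ nu.card + k := by
  have h : nu ≤ lam := by
    by_contra h
    rw [dualWeight_eq_zero _ hlam hnu h, Polynomial.coeff_zero] at hne
    exact hne rfl
  have hle := le_iff_rowLen.mp h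
  refine ⟨fun r => ⟨hle r, ?_⟩, ?_⟩
  · by_contra hr
    have hrL : r < L := by
      by_contra hrL
      rw [rowLen_eq_zero hlam (not_lt.mp hrL)] at hr
      omega
    rw [dualWeight, Finset.prod_eq_zero (Finset.mem_range.mpr hrL), Polynomial.coeff_zero] at hne
    · exact hne rfl
    · exact localWeight_eq_zero _ _ _ _ (by omega) (by omega)
  · by_contra hk
    rw [dualWeight_eq_pow_mul h hlam, Polynomial.coeff_X_pow_mul', if_neg (by omega)] at hne
    exact hne rfl

/-- The statistic `∑ binom(λ_i, 2)`. -/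
def colStat (lam : YoungDiagram) : ℕ :=
  ∑ r ∈ Finset.range (lam.colLen 0), (lam.rowLen r).choose 2

theorem colStat_eq_sum {lam : YoungDiagram} {L : ℕ} (h : lam.colLen 0 ≤ L) :
    colStat lam = ∑ r ∈ Finset.range L, (lam.rowLen r).choose 2 := by
  refine Finset.sum_subset (Finset.range_mono h) fun r _ hr => ?_
  rw [rowLen_eq_zero le_rfl (not_lt.mp (mt Finset.mem_range.mpr hr))]
  rfl

/-- The partition obtained by removing the first column. -/
def removeCol (lam : YoungDiagram) : YoungDiagram :=
  ofFun (fun r => lam.rowLen r - 1) (fun _ _ h => Nat.sub_le_sub_right (lam.rowLen_anti _ _ h) 1)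
    (lam.colLen 0) (by rw [rowLen_eq_zero le_rfl le_rfl])

@[simp] theorem rowLen_removeCol (lam : YoungDiagram) (r : ℕ) :
    (removeCol lam).rowLen r = lam.rowLen r - 1 := rowLen_ofFun _ _ _ _ _

theorem removeCol_le (lam : YoungDiagram) : removeCol lam ≤ lam :=
  le_iff_rowLen.mpr fun r => by
    rw [rowLen_removeCol]
    exact Nat.sub_le _ _

theorem rowLen_pos_iff {lam : YoungDiagram} {r : ℕ} : 0 < lam.rowLen r ↔ r < lam.colLen 0 := by
  rw [← YoungDiagram.mem_iff_lt_colLen, ← YoungDiagram.mem_iff_lt_rowLen]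

theorem card_removeCol (lam : YoungDiagram) : (removeCol lam).card + lam.colLen 0 = lam.card := by
  have h : lam.colLen 0 = ∑ r ∈ Finset.range (lam.colLen 0), 1 := by simp
  rw [card_eq_sum (colLen_zero_mono (removeCol_le lam)), card_eq_sum le_rfl]
  nth_rw 2 [h]
  rw [← Finset.sum_add_distrib]
  refine Finset.sum_congr rfl fun r hr => ?_
  have := rowLen_pos_iff.mpr (Finset.mem_range.mp hr)
  rw [rowLen_removeCol]
  omega

theorem choose_two_succ (n : ℕ) : (n + 1).choose 2 = n.choose 2 + n := by
  rw [Nat.choose_succ_succ' n 1, Nat.choose_one_right, add_comm]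

theorem colStat_removeCol (lam : YoungDiagram) :
    colStat lam = colStat (removeCol lam) + (removeCol lam).card := by
  have h := colLen_zero_mono (removeCol_le lam)
  rw [colStat_eq_sum le_rfl, colStat_eq_sum h, card_eq_sum h, ← Finset.sum_add_distrib]
  refine Finset.sum_congr rfl fun r hr => ?_
  obtain ⟨n, hn⟩ := Nat.exists_eq_succ_of_ne_zero
    (rowLen_pos_iff.mpr (Finset.mem_range.mp hr)).ne'
  rw [rowLen_removeCol, hn, Nat.succ_eq_add_one, choose_two_succ, Nat.add_sub_cancel]

/-- Enlarging a row of length n by one box adds n to its binomial, so the maximum is attained only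
if every non-empty row grows. -/
theorem colStat_le {mu nu : YoungDiagram}
    (h : ∀ r, nu.rowLen r ≤ mu.rowLen r ∧ mu.rowLen r ≤ nu.rowLen r + 1) :
    colStat mu ≤ colStat nu + nu.card ∧
      (colStat mu = colStat nu + nu.card →
        ∀ r, 0 < nu.rowLen r → mu.rowLen r = nu.rowLen r + 1) := by
  have hnu : nu.colLen 0 ≤ mu.colLen 0 := colLen_zero_mono (le_iff_rowLen.mpr fun r => (h r).1)
  rw [colStat_eq_sum le_rfl, colStat_eq_sum hnu, card_eq_sum hnu, ← Finset.sum_add_distrib]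
  have hcase : ∀ r, mu.rowLen r = nu.rowLen r ∨ mu.rowLen r = nu.rowLen r + 1 := fun r => by
    have := h r
    omega
  have hle : ∀ r ∈ Finset.range (mu.colLen 0),
      (mu.rowLen r).choose 2 ≤ (nu.rowLen r).choose 2 + nu.rowLen r := by
    intro r _
    rcases hcase r with hr | hr
    · rw [hr]
      exact Nat.le_add_right _ _
    · rw [hr, choose_two_succ]
  refine ⟨Finset.sum_le_sum hle, fun heq r hr => ?_⟩
  rcases hcase r with h1 | h1
  · have hr' := (rowLen_pos_iff.mp hr).trans_le hnu
    have h2 := (Finset.sum_eq_sum_iff_of_le hle).mp heq r (Finset.mem_range.mpr hr')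
    rw [h1] at h2
    omega
  · exact h1

/-- The exponent vector of the product of the generators given by the columns of a partition. -/
def colExponent {L : ℕ} (lam : BddLen L) : Fin L →₀ ℕ :=
  Finsupp.equivFunOnFinite.symm fun r => lam.1.rowLen r - lam.1.rowLen (r + 1)

@[simp] theorem colExponent_apply {L : ℕ} (lam : BddLen L) (r : Fin L) :
    colExponent lam r = lam.1.rowLen r - lam.1.rowLen (r + 1) := rfl

/-- This is the lowest power of x, so only the constant terms of the reduced weights matter. They
are 1 or -1, except at the last non-empty row, where 1 - q^(λ_r) appears up to sign. -/
theorem coeff_dualWeight_removeCol {L : ℕ} {lam : YoungDiagram} (hlam : lam.colLen 0 ≤ L)  :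
    (dualWeight L (Polynomial.X : Polynomial K) lam (removeCol lam)).coeff (lam.colLen 0) ≠ 0 := by
  have hc := card_removeCol lam
  rw [dualWeight_eq_pow_mul (removeCol_le lam) hlam, Polynomial.coeff_X_pow_mul',
    if_pos (by omega), show lam.colLen 0 - (lam.card - (removeCol lam).card) = 0 by omega,
    Polynomial.coeff_zero_eq_eval_zero, Polynomial.eval_prod]
  refine Finset.prod_ne_zero_iff.mpr fun r _ => ?_
  have h1 := rowLen_pos_iff (lam := lam) (r := r)
  have h2 := rowLen_pos_iff (lam := lam) (r := r + 1)
  rw [rowLen_removeCol, rowLen_removeCol, reducedWeight]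
  by_cases hr : 0 < lam.rowLen r
  · rw [if_neg (by omega), if_pos (by omega)]
    split_ifs with h3 h4
    · have h5 : lam.rowLen (r + 1) = 0 := by omega
      rw [h5, Nat.cast_zero, sub_zero, zpow_natCast]
      simpa using sub_ne_zero.mpr (sub_ne_zero.mp (one_sub_q_pow_ne_zero hr.ne')).symm
    · simp
    · omega
  · have := rowLen_succ_le lam r
    rw [if_pos (by omega), if_pos (by omega)]
    simp

theorem eq_of_removeCol {lam mu : YoungDiagram} (hcard : mu.card = lam.card)
    (h1 : ∀ r, (removeCol lam).rowLen r ≤ mu.rowLen r ∧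
      mu.rowLen r ≤ (removeCol lam).rowLen r + 1)
    (h2 : ∀ r, 0 < (removeCol lam).rowLen r → mu.rowLen r = (removeCol lam).rowLen r + 1) :
    mu = lam := by
  simp only [rowLen_removeCol] at h1 h2
  by_cases h : mu.colLen 0 ≤ lam.colLen 0
  · refine eq_of_le_of_card_le (le_iff_rowLen.mpr fun r => ?_) hcard.ge
    by_cases hr : r < lam.colLen 0
    · have := rowLen_pos_iff.mpr hr
      have := h1 r
      omega
    · rw [rowLen_eq_zero h (not_lt.mp hr)]
      exact Nat.zero_le _
  · refine (eq_of_le_of_card_le (le_iff_rowLen.mpr fun r => ?_) hcard.le).symm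
    by_cases hr : r < lam.colLen 0
    · have := rowLen_pos_iff.mpr (hr.trans (not_le.mp h))
      have := h2 r
      omega
    · rw [rowLen_eq_zero le_rfl (not_lt.mp hr)]
      exact Nat.zero_le _

/-- The generators occurring are D_k for the column lengths k of λ. D_k adds a vertical strip of at
most k boxes; as for rows, maximal size and `colStat` are reached only if each step adds a full new
first column. -/
theorem rho_monomial_colExponent {L : ℕ} (n : ℕ) (lam : BddLen L) (hn : lam.1.card = n) :
    (∀ mu : BddLen L, rho L (MvPolynomial.monomial (colExponent lam) 1) ⊥ mu ≠ 0 →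
      orderKey colStat mu.1 < orderKey colStat lam.1 ∨ mu = lam) ∧
    rho L (MvPolynomial.monomial (colExponent lam) 1) ⊥ lam ≠ 0 := by
  induction n using Nat.strong_induction_on generalizing lam with
  | _ n ih =>
  rcases hk : lam.1.colLen 0 with _ | k
  · have hlam : lam = ⊥ := Subtype.ext <| ext_rowLen fun r => by
      rw [rowLen_eq_zero hk.le (Nat.zero_le r)]
      simp
    have h0 : colExponent lam = 0 := by
      ext r
      simp [hlam]
    have h1 : (MvPolynomial.monomial (0 : Fin L →₀ ℕ) (1 : K)) = 1 := rfl
    rw [h0, h1, map_one]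
    constructor
    · intro mu h
      rw [IncidenceAlgebra.one_apply] at h
      right
      rw [hlam]
      by_contra h'
      exact h (if_neg fun h2 => h' h2.symm)
    · rw [hlam, IncidenceAlgebra.one_apply, if_pos rfl]
      exact one_ne_zero
  · let lam' : BddLen L := ⟨removeCol lam.1, (colLen_zero_mono (removeCol_le _)).trans lam.2⟩
    have hkL : k < L := by
      have := lam.2
      omega
    have hc := card_removeCol lam.1
    have hs := colStat_removeCol lam.1
    -- The first column has length k + 1, and the variable with index k is sent to D_{k+1}.
    have hexp : colExponent lam = colExponent lam' + Finsupp.single ⟨k, hkL⟩ 1 := by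
      ext ⟨r, hr⟩
      have h1 := rowLen_pos_iff (lam := lam.1) (r := r)
      have h2 := rowLen_pos_iff (lam := lam.1) (r := r + 1)
      simp only [lam', Finsupp.add_apply, colExponent_apply, rowLen_removeCol,
        Finsupp.single_apply, Fin.mk.injEq]
      split_ifs <;> omega
    obtain ⟨ih1, ih2⟩ := ih _ (by simp only [lam']; omega) lam' rfl
    have hmon : MvPolynomial.monomial (colExponent lam) (1 : K) =
        MvPolynomial.monomial (colExponent lam') 1 * MvPolynomial.X ⟨k, hkL⟩ := by
      rw [hexp, MvPolynomial.X, MvPolynomial.monomial_mul, mul_one]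
    have key : ∀ mu nu : BddLen L,
        rho L (MvPolynomial.monomial (colExponent lam') 1) ⊥ nu * dualElt L (k + 1) nu mu ≠ 0 →
        orderKey colStat mu.1 < orderKey colStat lam.1 ∨ (mu = lam ∧ nu = lam') := by
      intro mu nu h
      have h1 := ih1 nu (left_ne_zero_of_mul h)
      have h2 := right_ne_zero_of_mul h
      rw [dualElt_apply] at h2
      obtain ⟨h4, h3⟩ := coeff_dualWeight_ne_zero mu.2 nu.2 h2
      obtain ⟨h5, h6⟩ := colStat_le h4
      rw [orderKey_lt_iff] at h1 ⊢
      rcases h1 with (h1 | ⟨h1, h1'⟩) | h1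
      · left; left
        simp only [lam'] at h1
        omega
      · left
        simp only [lam'] at h1 h1'
        omega
      · subst h1
        simp only [lam'] at h3 h4 h5 h6
        by_cases h7 : colStat mu.1 = colStat (removeCol lam.1) + (removeCol lam.1).card ∧
            mu.1.card = lam.1.card
        · right
          exact ⟨Subtype.ext (eq_of_removeCol h7.2 h4 (h6 h7.1)), rfl⟩
        · left
          omega
    rw [hmon, map_mul, rho_X]
    constructor
    · intro mu h
      rw [IncidenceAlgebra.mul_apply] at h
      obtain ⟨nu, _, hnu⟩ := Finset.exists_ne_zero_of_sum_ne_zero h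
      exact (key mu nu hnu).imp_right And.left
    · rw [IncidenceAlgebra.mul_apply, Finset.sum_eq_single lam']
      · refine mul_ne_zero ih2 ?_
        have := coeff_dualWeight_removeCol lam.2
        rw [hk] at this
        exact this
      · intro nu _ hne
        by_contra h
        rcases key lam nu h with h1 | h1
        · exact lt_irrefl _ h1
        · exact hne h1.2
      · intro h
        have h1 : lam' ≤ lam := removeCol_le lam.1
        exact absurd (Finset.mem_Icc.mpr ⟨bot_le, h1⟩) h

theorem exists_colExponent_eq {L : ℕ} (m : Fin L →₀ ℕ) : ∃ lam : BddLen L, colExponent lam = m := by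
  -- The row lengths are the tail sums of `m`, whose consecutive differences recover `m`.
  have hanti : Antitone fun r : ℕ => ∑ i : Fin L, if r ≤ i then m i else 0 := by
    intro r s hrs
    refine Finset.sum_le_sum fun i _ => ?_
    split_ifs <;> omega
  have hL : (∑ i : Fin L, if L ≤ i then m i else 0) = 0 :=
    Finset.sum_eq_zero fun i _ => if_neg (not_le.mpr i.2)
  refine ⟨⟨ofFun _ hanti L hL, colLen_zero_le_iff.mpr (by rw [rowLen_ofFun, hL])⟩, ?_⟩
  ext r
  rw [colExponent_apply, rowLen_ofFun, rowLen_ofFun]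
  have h : (∑ i : Fin L, if (r : ℕ) ≤ i then m i else 0) =
      (∑ i : Fin L, if i = r then m i else 0) +
        ∑ i : Fin L, if (r : ℕ) + 1 ≤ i then m i else 0 := by
    rw [← Finset.sum_add_distrib]
    refine Finset.sum_congr rfl fun i _ => ?_
    have : i = r ↔ (i : ℕ) = r := Fin.ext_iff
    simp only [this]
    split_ifs <;> omega
  rw [h, Nat.add_sub_cancel]
  simp

theorem finite_rho_bot_ne_zero {L : ℕ} (P : MvPolynomial (Fin L) K) :
    {mu : BddLen L | rho L P ⊥ mu ≠ 0}.Finite := by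
  suffices h : ∃ N, ∀ mu : BddLen L, rho L P ⊥ mu ≠ 0 → mu.1.card ≤ N by
    obtain ⟨N, hN⟩ := h
    exact ((finite_card_le N).preimage Subtype.val_injective.injOn).subset hN
  induction P using MvPolynomial.induction_on with
  | C a =>
    refine ⟨0, fun mu h => ?_⟩
    have h1 : rho L (MvPolynomial.C a) = a • 1 := by
      rw [← MvPolynomial.algebraMap_eq, AlgHom.commutes, Algebra.algebraMap_eq_smul_one]
    rw [h1, IncidenceAlgebra.constSMul_apply, IncidenceAlgebra.one_apply] at h
    have h2 : ⊥ = mu := by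
      by_contra h'
      rw [if_neg h', smul_zero] at h
      exact h rfl
    rw [← h2]
    rfl
  | add P Q hP hQ =>
    obtain ⟨N, hN⟩ := hP
    obtain ⟨M, hM⟩ := hQ
    refine ⟨max N M, fun mu h => ?_⟩
    rw [map_add, IncidenceAlgebra.add_apply] at h
    by_cases h1 : rho L P ⊥ mu = 0
    · rw [h1, zero_add] at h
      exact (hM mu h).trans (le_max_right _ _)
    · exact (hN mu h1).trans (le_max_left _ _)
  | mul_X P r hP =>
    obtain ⟨N, hN⟩ := hP
    refine ⟨N + (r + 1), fun mu h => ?_⟩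
    rw [map_mul, rho_X, IncidenceAlgebra.mul_apply] at h
    obtain ⟨nu, _, hnu⟩ := Finset.exists_ne_zero_of_sum_ne_zero h
    have h1 := hN nu (left_ne_zero_of_mul hnu)
    have h2 := (coeff_dualWeight_ne_zero mu.2 nu.2 (right_ne_zero_of_mul hnu)).2
    omega

/-- The image of the vacuum under an element of the polynomial ring. -/
def vacuumImage (L : ℕ) : MvPolynomial (Fin L) K →ₗ[K] BddLen L →₀ K where
  toFun P := Finsupp.ofSupportFinite (fun mu => rho L P ⊥ mu) (finite_rho_bot_ne_zero P)
  map_add' P Q := by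
    ext mu
    change rho L (P + Q) ⊥ mu = rho L P ⊥ mu + rho L Q ⊥ mu
    rw [map_add, IncidenceAlgebra.add_apply]
  map_smul' a P := by
    ext mu
    change rho L (a • P) ⊥ mu = a • rho L P ⊥ mu
    rw [map_smul, IncidenceAlgebra.constSMul_apply]

theorem vacuumImage_apply {L : ℕ} (P : MvPolynomial (Fin L) K) (mu : BddLen L) :
    vacuumImage L P mu = rho L P ⊥ mu := rfl

/-- Monomials correspond to partitions through their columns. In a non-zero P, take the monomial
with the largest key: no other monomial of P reaches its partition, where its own entry is non-zero.
-/
theorem vacuumImage_injective (L : ℕ) : Function.Injective (vacuumImage L) := by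
  rw [injective_iff_map_eq_zero]
  intro P hP
  by_contra hne
  choose lam hlam using exists_colExponent_eq (L := L)
  obtain ⟨m, hm, hmax⟩ := Finset.exists_max_image P.support
    (fun m => orderKey colStat (lam m).1) (MvPolynomial.support_nonempty.mpr hne)
  have h1 : vacuumImage L P (lam m) = 0 := by rw [hP, Finsupp.zero_apply]
  have h2 : vacuumImage L P (lam m) = ∑ m' ∈ P.support,
      P.coeff m' * rho L (MvPolynomial.monomial (colExponent (lam m')) 1) ⊥ (lam m) := by
    conv_lhs => rw [P.as_sum]
    rw [map_sum, Finsupp.finsetSum_apply]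
    refine Finset.sum_congr rfl fun m' _ => ?_
    have h3 : MvPolynomial.monomial m' (P.coeff m') =
        P.coeff m' • MvPolynomial.monomial (colExponent (lam m')) (1 : K) := by
      rw [hlam, MvPolynomial.smul_monomial, smul_eq_mul, mul_one]
    rw [h3, map_smul, Finsupp.smul_apply, vacuumImage_apply, smul_eq_mul]
  rw [h1, Finset.sum_eq_single m] at h2
  · exact mul_ne_zero (MvPolynomial.mem_support_iff.mp hm)
      (rho_monomial_colExponent _ (lam m) rfl).2 h2.symm
  · intro m' hm' hne'
    by_contra h
    rcases (rho_monomial_colExponent _ (lam m') rfl).1 (lam m) (right_ne_zero_of_mul h) with h3 | h3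
    · exact absurd (hmax m' hm') (not_le.mpr h3)
    · exact hne' (by rw [← hlam m', ← h3, hlam])
  · exact fun h => absurd hm h

/-! ### Expansions -/

/-- A power series whose coefficients are given by a functional on solutions of the `q`-difference
equation is an infinite linear combination of functions indexed by partitions of bounded length. -/
theorem exists_isExpansion {R : Type*} [CommRing R] [Algebra K R] {L : ℕ} {c t : ℕ → R}
    (h0 : c 0 = 1) (hL : ∀ k, L < k → c k = 0) (ht0 : t 0 = 1) (h : IsSolution L c t)
    (phi : R →ₗ[K] K) (f : MvPowerSeries ℕ K)
    (hf : ∀ d, MvPowerSeries.coeff d f = phi (d.prod fun _ k => t k)) :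
    ∃ a : YoungDiagram → K, (∀ lam : YoungDiagram, L < lam.colLen 0 → a lam = 0) ∧
      IsExpansion f a := by
  classical
  -- A linear left inverse recovers `monomialElt L d` from its vacuum row, so `phi` becomes a
  -- functional of that row; its values on the basis vectors are the expansion coefficients.
  obtain ⟨g, hg⟩ := LinearMap.exists_leftInverse_of_injective (vacuumImage L)
    (LinearMap.ker_eq_bot.mpr (vacuumImage_injective L))
  let ev := MvPolynomial.aeval (R := K) fun r : Fin L => c (r + 1)
  let a : YoungDiagram → K := fun lam =>
    if hlam : lam.colLen 0 ≤ L then phi (ev (g (Finsupp.single ⟨lam, hlam⟩ 1))) else 0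
  refine ⟨a, fun lam hlam => dif_neg (not_le.mpr hlam), fun d => ?_⟩
  have h1 : d.prod (fun _ k => t k) = ev (monomialElt L d) := by
    rw [monomialElt, map_finsuppProd]
    exact Finsupp.prod_congr fun i _ => (aeval_genericSolution h0 hL ht0 h _).symm
  have h2 : monomialElt L d = (vacuumImage L (monomialElt L d)).sum fun lam x =>
      x • g (Finsupp.single lam 1) := by
    have h3 : g (vacuumImage L (monomialElt L d)) = monomialElt L d := LinearMap.congr_fun hg _
    conv_lhs => rw [← h3, ← Finsupp.sum_single (vacuumImage L (monomialElt L d)), map_finsuppSum]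
    refine Finsupp.sum_congr fun lam _ => ?_
    rw [← map_smul, Finsupp.smul_single, smul_eq_mul, mul_one]
  have h4 : ∀ lam : BddLen L, vacuumImage L (monomialElt L d) lam =
      MvPowerSeries.coeff d (F lam) := by
    intro lam
    rw [F, ← coe_bot_bddLen L, coeff_skewF_eq]
    rfl
  rw [hf, h1, h2, Finsupp.sum, map_sum, map_sum,
    finsum_eq_sum_of_support_subset (s := (vacuumImage L (monomialElt L d)).support.map
      (Function.Embedding.subtype _))]
  · rw [Finset.sum_map]
    refine Finset.sum_congr rfl fun lam _ => ?_
    rw [map_smul, map_smul, smul_eq_mul, h4, mul_comm]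
    congr 1
    have h5 : a lam.1 = phi (ev (g (Finsupp.single lam 1))) := dif_pos lam.2
    exact h5.symm
  · intro lam hlam
    have h5 : lam.colLen 0 ≤ L := by
      by_contra h5
      exact left_ne_zero_of_mul hlam (dif_neg h5)
    rw [Finset.coe_map]
    refine ⟨⟨lam, h5⟩, ?_, rfl⟩
    rw [Finset.mem_coe, Finsupp.mem_support_iff, h4]
    exact right_ne_zero_of_mul hlam

theorem isExpansion_finsupp (c : YoungDiagram →₀ K) :
    IsExpansion (c.sum fun lam a => a • F lam) c := by
  intro d
  rw [finsum_eq_sum_of_support_subset (s := c.support), Finsupp.sum, map_sum]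
  · exact Finset.sum_congr rfl fun lam _ => by rw [map_smul, smul_eq_mul]
  · exact fun lam h => Finsupp.mem_support_iff.mpr (left_ne_zero_of_mul h)

theorem IsExpansion.eq_of_eq {f g : MvPowerSeries ℕ K} {c : YoungDiagram → K}
    (h : IsExpansion f c) (h' : IsExpansion g c) : f = g := by
  ext d
  rw [h, h']

/-- The length is bounded by L by construction and the first row by N through
`IsExpansion.eq_zero_of_lt`, so the support lies in a finite box. -/
theorem exists_finsupp_eq_sum {R : Type*} [CommRing R] [Algebra K R] {L N : ℕ} {c t : ℕ → R}
    (h0 : c 0 = 1) (hL : ∀ k, L < k → c k = 0) (ht0 : t 0 = 1) (h : IsSolution L c t)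
    (phi : R →ₗ[K] K) (f : MvPowerSeries ℕ K)
    (hf : ∀ d, MvPowerSeries.coeff d f = phi (d.prod fun _ k => t k))
    (hN : ∀ d : ℕ →₀ ℕ, N < d 0 → MvPowerSeries.coeff d f = 0) :
    ∃ a : YoungDiagram →₀ K, f = a.sum fun lam x => x • F lam := by
  obtain ⟨a, ha, hfa⟩ := exists_isExpansion h0 hL ht0 h phi f hf
  have hfin : (Function.support a).Finite := by
    refine (finite_box N L).subset fun lam hlam => ⟨?_, ?_⟩
    · by_contra h1
      exact hlam (ha lam (not_le.mp h1))
    · by_contra h1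
      exact hlam (hfa.eq_zero_of_lt hN (not_le.mp h1))
  exact ⟨Finsupp.ofSupportFinite a hfin, hfa.eq_of_eq (isExpansion_finsupp _)⟩

/-! ### Products -/

theorem sum_antidiagonal_add_of_disjoint {M : Type*} [AddCommMonoid M] {d e : ℕ →₀ ℕ}
    (h : Disjoint d.support e.support) (G : (ℕ →₀ ℕ) × (ℕ →₀ ℕ) → M) :
    ∑ ab ∈ antidiagonal (d + e), G ab =
      ∑ x ∈ antidiagonal d, ∑ y ∈ antidiagonal e, G (x.1 + y.1, x.2 + y.2) := by
  have key : ∀ i, d i = 0 ∨ e i = 0 := fun i => by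
    by_contra! hi
    exact Finset.disjoint_left.mp h (Finsupp.mem_support_iff.mpr hi.1)
      (Finsupp.mem_support_iff.mpr hi.2)
  rw [← Finset.sum_product']
  refine (Finset.sum_nbij' (fun xy => (xy.1.1 + xy.2.1, xy.1.2 + xy.2.2))
    (fun ab => ((ab.1.filter fun i => d i ≠ 0, ab.2.filter fun i => d i ≠ 0),
      (ab.1.filter fun i => d i = 0, ab.2.filter fun i => d i = 0))) ?_ ?_ ?_ ?_ ?_).symm
  · rintro ⟨⟨x, x'⟩, ⟨y, y'⟩⟩ hxy
    simp only [Finset.mem_product, Finset.HasAntidiagonal.mem_antidiagonal] at hxy ⊢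
    rw [← hxy.1, ← hxy.2]
    abel
  · rintro ⟨a, b⟩ hab
    simp only [Finset.mem_product, Finset.HasAntidiagonal.mem_antidiagonal] at hab ⊢
    rw [← Finsupp.filter_add, ← Finsupp.filter_add, hab]
    constructor <;> ext i <;> have := key i <;> simp only [Finsupp.filter_apply,
      Finsupp.add_apply] <;> split_ifs <;> omega
  · rintro ⟨⟨x, x'⟩, ⟨y, y'⟩⟩ hxy
    simp only [Finset.mem_product, Finset.HasAntidiagonal.mem_antidiagonal] at hxy
    have hx : ∀ i, x i + x' i = d i := fun i => DFunLike.congr_fun hxy.1 i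
    have hy : ∀ i, y i + y' i = e i := fun i => DFunLike.congr_fun hxy.2 i
    refine Prod.ext (Prod.ext ?_ ?_) (Prod.ext ?_ ?_) <;> ext i <;> have := key i <;>
      have := hx i <;> have := hy i <;> simp only [Finsupp.filter_apply, Finsupp.add_apply] <;>
      split_ifs <;> omega
  · rintro ⟨a, b⟩ _
    refine Prod.ext ?_ ?_ <;> ext i <;> simp only [Finsupp.filter_apply, Finsupp.add_apply] <;>
      split_ifs <;> omega
  · rintro ⟨⟨x, x'⟩, ⟨y, y'⟩⟩ _
    rfl

theorem prod_sum_antidiagonal {A : Type*} [CommSemiring A] {p r : ℕ → A} (hp : p 0 = 1)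
    (hr : r 0 = 1) (d : ℕ →₀ ℕ) :
    d.prod (fun _ k => ∑ ij ∈ antidiagonal k, p ij.1 * r ij.2) =
      ∑ ab ∈ antidiagonal d, (ab.1.prod fun _ k => p k) * ab.2.prod fun _ k => r k := by
  induction d using Finsupp.induction with
  | zero => simp
  | single_add i n d hi _ ih =>
    have hd : Disjoint (Finsupp.single i n).support d.support :=
      Finset.disjoint_of_subset_left Finsupp.support_single_subset (by simpa using hi)
    rw [Finsupp.prod_add_index_of_disjoint hd, sum_antidiagonal_add_of_disjoint hd, ih,
      Finsupp.prod_single_index (by simp [hp, hr]), Finset.sum_mul_sum, Finsupp.antidiagonal_single,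
      Finset.sum_map]
    refine Finset.sum_congr rfl fun ij _ => Finset.sum_congr rfl fun ab hab => ?_
    rw [Finset.HasAntidiagonal.mem_antidiagonal] at hab
    have h1 : ∀ (k : ℕ) {a : ℕ →₀ ℕ}, a ≤ d → Disjoint (Finsupp.single i k).support a.support :=
      fun k a ha => Finset.disjoint_of_subset_left Finsupp.support_single_subset <|
        Finset.disjoint_singleton_left.mpr fun h => hi (Finsupp.support_mono ha h)
    change _ = ((Finsupp.single i ij.1 + ab.1).prod fun _ k => p k) *
      (Finsupp.single i ij.2 + ab.2).prod fun _ k => r k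
    rw [Finsupp.prod_add_index_of_disjoint (h1 _ (hab ▸ le_self_add)),
      Finsupp.prod_add_index_of_disjoint (h1 _ (hab ▸ le_add_self)),
      Finsupp.prod_single_index (h := fun _ k => p k) hp,
      Finsupp.prod_single_index (h := fun _ k => r k) hr]
    ring

theorem genericCoeff_eq_zero {L k : ℕ} (h : L < k) : genericCoeff L k = 0 := by
  obtain _ | k := k
  · omega
  · rw [genericCoeff, dif_neg (by omega)]

/-- In the tensor product of the two polynomial rings, the generic solutions multiply to a solution
for L + M. The functional `phi`, a product of two vacuum matrix elements, turns its monomials into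
the coefficients of the product, whose degree in x_0 is at most μ_1 + ν_1. -/
theorem exists_F_mul_F_eq_sum (mu nu : YoungDiagram) :
    ∃ c : YoungDiagram →₀ K, F mu * F nu = c.sum fun lam a => a • F lam := by
  let L := mu.colLen 0
  let M := nu.colLen 0
  let mu' : BddLen L := ⟨mu, le_rfl⟩
  let nu' : BddLen M := ⟨nu, le_rfl⟩
  let i₁ : MvPolynomial (Fin L) K →ₐ[K] MvPolynomial (Fin L) K ⊗[K] MvPolynomial (Fin M) K :=
    Algebra.TensorProduct.includeLeft
  let i₂ : MvPolynomial (Fin M) K →ₐ[K] MvPolynomial (Fin L) K ⊗[K] MvPolynomial (Fin M) K :=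
    Algebra.TensorProduct.includeRight
  let phi : MvPolynomial (Fin L) K ⊗[K] MvPolynomial (Fin M) K →ₗ[K] K :=
    LinearMap.mul' K K ∘ₗ TensorProduct.map (entry ⊥ mu' ∘ₗ (rho L).toLinearMap)
      (entry ⊥ nu' ∘ₗ (rho M).toLinearMap)
  have hsol := ((isSolution_genericSolution L).map i₁).mul ((isSolution_genericSolution M).map i₂)
  refine exists_finsupp_eq_sum (N := mu.rowLen 0 + nu.rowLen 0) ?_ ?_ ?_ hsol phi (F mu * F nu)
    ?_ ?_
  · simp [genericCoeff]
  · intro k hk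
    refine Finset.sum_eq_zero fun ij hij => ?_
    rw [Finset.HasAntidiagonal.mem_antidiagonal] at hij
    by_cases h : L < ij.1
    · simp [genericCoeff_eq_zero h]
    · simp [genericCoeff_eq_zero (show M < ij.2 by omega)]
  · simp [genericSolution_zero]
  · intro d
    rw [prod_sum_antidiagonal (p := fun k => i₁ (genericSolution L k))
      (r := fun k => i₂ (genericSolution M k)) (by rw [genericSolution_zero, map_one])
      (by rw [genericSolution_zero, map_one]), map_sum, MvPowerSeries.coeff_mul]
    refine Finset.sum_congr rfl fun ab _ => ?_
    rw [← map_finsuppProd i₁, ← map_finsuppProd i₂]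
    change _ * _ = phi (i₁ (monomialElt L ab.1) * i₂ (monomialElt M ab.2))
    have h1 : i₁ (monomialElt L ab.1) * i₂ (monomialElt M ab.2) =
        monomialElt L ab.1 ⊗ₜ monomialElt M ab.2 := by
      simp [i₁, i₂]
    rw [h1, F, F]
    have h2 := coeff_skewF_eq mu' ⊥ ab.1
    have h3 := coeff_skewF_eq nu' ⊥ ab.2
    rw [coe_bot_bddLen] at h2 h3
    rw [h2, h3]
    rfl
  · intro d hd
    rw [MvPowerSeries.coeff_mul]
    refine Finset.sum_eq_zero fun ab hab => ?_
    rw [Finset.HasAntidiagonal.mem_antidiagonal] at hab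
    have h0 : ab.1 0 + ab.2 0 = d 0 := DFunLike.congr_fun hab 0
    by_cases h : mu.rowLen 0 < ab.1 0
    · rw [F, coeff_skewF_eq_zero_of_lt h, zero_mul]
    · rw [F, F, coeff_skewF_eq_zero_of_lt (lam := nu) (d := ab.2) (i := 0) (by omega), mul_zero]

theorem exists_skewF_eq_sum (lam mu : YoungDiagram) :
    ∃ c : YoungDiagram →₀ K, skewF lam mu = c.sum fun nu a => a • F nu := by
  let L := max (lam.colLen 0) (mu.colLen 0)
  let lam' : BddLen L := ⟨lam, le_max_left _ _⟩
  let mu' : BddLen L := ⟨mu, le_max_right _ _⟩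
  exact exists_finsupp_eq_sum (N := lam.rowLen 0) (L := L) rfl (fun k => genericCoeff_eq_zero)
    (genericSolution_zero L) (isSolution_genericSolution L)
    (entry mu' lam' ∘ₗ (rho L).toLinearMap) (skewF lam mu)
    (coeff_skewF_eq lam' mu') fun d => coeff_skewF_eq_zero_of_lt

/-! ### The algebra spanned by the inhomogeneous `q`-Whittaker functions -/

theorem F_bot : F ⊥ = 1 := by
  ext d
  have h := coeff_skewF_eq (L := 0) ⊥ ⊥ d
  rw [coe_bot_bddLen] at h
  have hbot : ∀ nu : BddLen 0, nu = ⊥ := fun nu => Subtype.ext <| ext_rowLen fun r => by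
    rw [rowLen_eq_zero nu.2 (Nat.zero_le r)]
    simp
  by_cases hd : d = 0
  · subst hd
    rw [F, h, monomialElt, Finsupp.prod_zero_index, map_one, IncidenceAlgebra.one_apply,
      if_pos rfl, MvPowerSeries.coeff_zero_one]
  · obtain ⟨i, hi⟩ := Finsupp.ne_iff.mp hd
    rw [F, MvPowerSeries.coeff_one, if_neg hd]
    refine coeff_skewF_eq_zero_of_lt (i := i) ?_
    rw [rowLen_bot]
    exact Nat.pos_of_ne_zero hi

theorem mem_span_F_iff {f : MvPowerSeries ℕ K} :
    f ∈ Submodule.span K (Set.range F) ↔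
      ∃ c : YoungDiagram →₀ K, f = c.sum fun lam a => a • F lam := by
  rw [Finsupp.mem_span_range_iff_exists_finsupp]
  exact exists_congr fun c => eq_comm

/-- The subalgebra spanned by the inhomogeneous `q`-Whittaker functions. -/
def Gam : Subalgebra K (MvPowerSeries ℕ K) :=
  (Submodule.span K (Set.range F)).toSubalgebra
    (F_bot ▸ Submodule.subset_span (Set.mem_range_self ⊥)) fun x y hx hy => by
      have h := Submodule.mul_mem_mul hx hy
      rw [Submodule.span_mul_span] at h
      refine Submodule.span_le.mpr ?_ h
      rintro _ ⟨_, ⟨mu, rfl⟩, _, ⟨nu, rfl⟩, rfl⟩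
      exact mem_span_F_iff.mpr (exists_F_mul_F_eq_sum mu nu)

theorem Gam_le_LamHat : Gam ≤ LamHat :=
  Submodule.span_le (p := Subalgebra.toSubmodule LamHat).mpr <| by
    rintro _ ⟨lam, rfl⟩
    exact skewF_mem_LamHat lam ⊥

theorem skewF_mem_Gam (lam mu : YoungDiagram) : skewF lam mu ∈ Gam :=
  mem_span_F_iff.mpr (exists_skewF_eq_sum lam mu)

theorem linearIndependent_F : LinearIndependent K F := by
  rw [linearIndependent_iff]
  intro c hc
  have h1 := isExpansion_finsupp c
  have h2 := isExpansion_finsupp 0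
  rw [Finsupp.sum_zero_index] at h2
  rw [Finsupp.linearCombination_apply] at hc
  rw [hc] at h1
  exact DFunLike.coe_injective (h1.unique h2)

/-- The basis of `Gam` given by the inhomogeneous `q`-Whittaker functions. -/
def basisF : Module.Basis YoungDiagram K Gam := Module.Basis.span linearIndependent_F

theorem coe_basisF (lam : YoungDiagram) : (basisF lam : MvPowerSeries ℕ K) = F lam :=
  congrArg Subtype.val (Module.Basis.span_apply linearIndependent_F lam)

/-! ### Separating tensors by pairs of functionals -/

section Pairing

variable {U V W : Type*} [AddCommGroup U] [Module K U] [AddCommGroup V] [Module K V]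
  [AddCommGroup W] [Module K W]

/-- The product of two functionals, as a functional on the tensor product. -/
def pairing (f : V →ₗ[K] K) (g : W →ₗ[K] K) : V ⊗[K] W →ₗ[K] K :=
  LinearMap.mul' K K ∘ₗ TensorProduct.map f g

@[simp] theorem pairing_tmul (f : V →ₗ[K] K) (g : W →ₗ[K] K) (v : V) (w : W) :
    pairing f g (v ⊗ₜ w) = f v * g w := rfl

theorem pairing_rTensor (f : V →ₗ[K] K) (g : W →ₗ[K] K) (phi : U →ₗ[K] V) (z : U ⊗[K] W) :
    pairing f g (phi.rTensor W z) = pairing (f ∘ₗ phi) g z := by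
  induction z with
  | zero => rw [map_zero, map_zero, map_zero]
  | tmul u w => rfl
  | add z z' hz hz' => rw [map_add, map_add, map_add, hz, hz']

theorem pairing_lTensor (f : V →ₗ[K] K) (g : W →ₗ[K] K) (phi : U →ₗ[K] W) (z : V ⊗[K] U) :
    pairing f g (phi.lTensor V z) = pairing f (g ∘ₗ phi) z := by
  induction z with
  | zero => rw [map_zero, map_zero, map_zero]
  | tmul v u => rfl
  | add z z' hz hz' => rw [map_add, map_add, map_add, hz, hz']

theorem pairing_assoc (f : U →ₗ[K] K) (g : V →ₗ[K] K) (h : W →ₗ[K] K) (z : (U ⊗[K] V) ⊗[K] W) :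
    pairing f (pairing g h) (TensorProduct.assoc K U V W z) = pairing (pairing f g) h z := by
  have key : pairing f (pairing g h) ∘ₗ (TensorProduct.assoc K U V W).toLinearMap =
      pairing (pairing f g) h := TensorProduct.ext_threefold fun u v w => (mul_assoc _ _ _).symm
  exact LinearMap.congr_fun key z

theorem pairing_comm (f : V →ₗ[K] K) (g : W →ₗ[K] K) (z : W ⊗[K] V) :
    pairing f g (TensorProduct.comm K W V z) = pairing g f z := by
  have key : pairing f g ∘ₗ (TensorProduct.comm K W V).toLinearMap = pairing g f :=
    TensorProduct.ext' fun w v => mul_comm _ _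
  exact LinearMap.congr_fun key z

theorem apply_lid_rTensor (f : V →ₗ[K] K) (g : W →ₗ[K] K) (z : V ⊗[K] W) :
    g (TensorProduct.lid K W (f.rTensor W z)) = pairing f g z := by
  have key : g ∘ₗ (TensorProduct.lid K W).toLinearMap ∘ₗ f.rTensor W = pairing f g :=
    TensorProduct.ext' fun v w => by simp
  exact LinearMap.congr_fun key z

theorem apply_rid_lTensor (f : V →ₗ[K] K) (g : W →ₗ[K] K) (z : V ⊗[K] W) :
    f (TensorProduct.rid K V (g.lTensor V z)) = pairing f g z := by
  have key : f ∘ₗ (TensorProduct.rid K V).toLinearMap ∘ₗ g.lTensor V = pairing f g :=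
    TensorProduct.ext' fun v w => by simp [mul_comm]
  exact LinearMap.congr_fun key z

/-- Contracting the first factor of the difference with any `f i` gives a vector killed by all `g
j`, hence zero. So the components of the difference along a basis of W are killed by all `f i`. -/
theorem tensor_ext {ι κ : Type*} {f : ι → V →ₗ[K] K} (hf : ∀ v, (∀ i, f i v = 0) → v = 0)
    {g : κ → W →ₗ[K] K} (hg : ∀ w, (∀ j, g j w = 0) → w = 0)
    {x y : V ⊗[K] W} (h : ∀ i j, pairing (f i) (g j) x = pairing (f i) (g j) y) : x = y := by
  classical
  rw [← sub_eq_zero]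
  have hz : ∀ i j, pairing (f i) (g j) (x - y) = 0 := fun i j => by rw [map_sub, h, sub_self]
  generalize x - y = z at hz ⊢
  have h1 : ∀ i, TensorProduct.lid K W ((f i).rTensor W z) = 0 := fun i => hg _ fun j => by
    rw [apply_lid_rTensor, hz i j]
  let B := Module.Basis.ofVectorSpace K W
  refine (TensorProduct.equivFinsuppOfBasisRight B).injective ?_
  rw [map_zero]
  ext k
  refine hf _ fun i => ?_
  rw [TensorProduct.equivFinsuppOfBasisRight_apply, apply_rid_lTensor, ← apply_lid_rTensor, h1,
    map_zero]

end Pairing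

/-! ### Coefficients of the elements of the algebra -/

/-- The coefficient functionals. -/
def coeffGam (d : ℕ →₀ ℕ) : Gam →ₗ[K] K := MvPowerSeries.coeff d ∘ₗ Gam.val.toLinearMap

theorem coeffGam_apply (d : ℕ →₀ ℕ) (f : Gam) :
    coeffGam d f = MvPowerSeries.coeff d (f : MvPowerSeries ℕ K) := rfl

theorem eq_zero_of_coeffGam (f : Gam) (h : ∀ d, coeffGam d f = 0) : f = 0 :=
  Subtype.ext <| MvPowerSeries.ext h

/-- This is how symmetry enters the bialgebra axioms: exponent vectors differing by a relabelling of
the variables define the same functional. -/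
theorem coeffGam_congr {d e : ℕ →₀ ℕ} (h : ∀ L, monomialElt L d = monomialElt L e) :
    coeffGam d = coeffGam e := by
  refine basisF.ext fun lam => ?_
  have h1 := coeff_skewF_eq (L := lam.colLen 0) ⟨lam, le_rfl⟩ ⊥
  rw [coe_bot_bddLen] at h1
  rw [coeffGam_apply, coeffGam_apply, coe_basisF, F, h1, h1, h]

/-- The exponent vector with `d` on the even and `e` on the odd variables. -/
def interleave (d e : ℕ →₀ ℕ) : ℕ →₀ ℕ :=
  d.mapDomain (fun i => 2 * i) + e.mapDomain fun i => 2 * i + 1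

theorem two_mul_injective : Function.Injective fun i : ℕ => 2 * i :=
  fun i j (h : 2 * i = 2 * j) => by omega

theorem two_mul_add_one_injective : Function.Injective fun i : ℕ => 2 * i + 1 :=
  fun i j (h : 2 * i + 1 = 2 * j + 1) => by omega

theorem disjoint_interleave (d e : ℕ →₀ ℕ) :
    Disjoint (d.mapDomain fun i => 2 * i).support (e.mapDomain fun i => 2 * i + 1).support := by
  classical
  rw [Finsupp.mapDomain_support_of_injective two_mul_injective,
    Finsupp.mapDomain_support_of_injective two_mul_add_one_injective, Finset.disjoint_left]
  intro i h1 h2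
  obtain ⟨j, _, hj⟩ := Finset.mem_image.mp h1
  obtain ⟨k, _, hk⟩ := Finset.mem_image.mp h2
  omega

theorem monomialElt_interleave (L : ℕ) (d e : ℕ →₀ ℕ) :
    monomialElt L (interleave d e) = monomialElt L d * monomialElt L e := by
  rw [interleave, monomialElt_add (disjoint_interleave d e),
    monomialElt_mapDomain _ _ two_mul_injective,
    monomialElt_mapDomain _ _ two_mul_add_one_injective]

theorem sum_antidiagonal_mapDomain {M : Type*} [AddCommMonoid M] {e : ℕ → ℕ}
    (he : Function.Injective e) (d : ℕ →₀ ℕ) (G : (ℕ →₀ ℕ) × (ℕ →₀ ℕ) → M) :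
    ∑ ab ∈ antidiagonal (d.mapDomain e), G ab =
      ∑ ab ∈ antidiagonal d, G (ab.1.mapDomain e, ab.2.mapDomain e) := by
  classical
  have hinj := Finsupp.mapDomain_injective (M := ℕ) he
  refine (Finset.sum_nbij (fun ab => (ab.1.mapDomain e, ab.2.mapDomain e)) ?_ ?_ ?_ ?_).symm
  · intro ab hab
    rw [Finset.HasAntidiagonal.mem_antidiagonal] at hab ⊢
    rw [← Finsupp.mapDomain_add, hab]
  · intro ab _ ab' _ h
    exact Prod.ext (hinj (congrArg Prod.fst h)) (hinj (congrArg Prod.snd h))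
  · rintro ⟨a, b⟩ hab
    rw [Finset.mem_coe, Finset.HasAntidiagonal.mem_antidiagonal] at hab
    have hrange : ∀ {c : ℕ →₀ ℕ}, c ≤ d.mapDomain e → ∃ c', Finsupp.mapDomain e c' = c := by
      intro c hc
      refine ⟨c.comapDomain e he.injOn, Finsupp.mapDomain_comapDomain e he c ?_⟩
      refine (Finset.coe_subset.mpr (Finsupp.support_mono hc)).trans ?_
      rw [Finsupp.mapDomain_support_of_injective he, Finset.coe_image]
      exact Set.image_subset_range _ _
    obtain ⟨a, rfl⟩ := hrange (hab ▸ le_self_add : a ≤ _)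
    obtain ⟨b, rfl⟩ := hrange (hab ▸ le_add_self : b ≤ _)
    refine ⟨(a, b), ?_, rfl⟩
    rw [Finset.mem_coe, Finset.HasAntidiagonal.mem_antidiagonal]
    refine hinj ?_
    rw [Finsupp.mapDomain_add]
    exact hab
  · exact fun _ _ => rfl

theorem coeffGam_mul (d : ℕ →₀ ℕ) (f g : Gam) : coeffGam d (f * g) =
    ∑ ab ∈ antidiagonal d, coeffGam ab.1 f * coeffGam ab.2 g := by
  classical
  rw [coeffGam_apply, Subalgebra.coe_mul, MvPowerSeries.coeff_mul]
  rfl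

theorem coeffGam_interleave_mul (d e : ℕ →₀ ℕ) (f g : Gam) : coeffGam (interleave d e) (f * g) =
    ∑ x ∈ antidiagonal d, ∑ y ∈ antidiagonal e,
      coeffGam (interleave x.1 y.1) f * coeffGam (interleave x.2 y.2) g := by
  rw [coeffGam_mul, interleave, sum_antidiagonal_add_of_disjoint (disjoint_interleave d e),
    sum_antidiagonal_mapDomain two_mul_injective]
  refine Finset.sum_congr rfl fun x _ => ?_
  rw [sum_antidiagonal_mapDomain two_mul_add_one_injective]
  rfl

theorem pairing_mul (d e : ℕ →₀ ℕ) (x y : Gam ⊗[K] Gam) :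
    pairing (coeffGam d) (coeffGam e) (x * y) =
      ∑ a ∈ antidiagonal d, ∑ b ∈ antidiagonal e,
        pairing (coeffGam a.1) (coeffGam b.1) x * pairing (coeffGam a.2) (coeffGam b.2) y := by
  induction x with
  | zero => simp
  | add x x' hx hx' => simp only [add_mul, map_add, hx, hx', Finset.sum_add_distrib]
  | tmul f f' =>
    induction y with
    | zero => simp
    | add y y' hy hy' => simp only [mul_add, map_add, hy, hy', Finset.sum_add_distrib]
    | tmul g g' =>
      rw [Algebra.TensorProduct.tmul_mul_tmul, pairing_tmul, coeffGam_mul, coeffGam_mul,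
        Finset.sum_mul_sum]
      refine Finset.sum_congr rfl fun a _ => Finset.sum_congr rfl fun b _ => ?_
      rw [pairing_tmul, pairing_tmul]
      ring

/-! ### The bialgebra structure -/

/-- The coproduct as a linear map. -/
def comulLin : Gam →ₗ[K] Gam ⊗[K] Gam :=
  basisF.constr K fun lam =>
    ∑ mu ∈ below lam, (⟨skewF lam mu, skewF_mem_Gam lam mu⟩ : Gam) ⊗ₜ basisF mu

theorem comulLin_basisF (lam : YoungDiagram) : comulLin (basisF lam) =
    ∑ mu ∈ below lam, (⟨skewF lam mu, skewF_mem_Gam lam mu⟩ : Gam) ⊗ₜ basisF mu :=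
  basisF.constr_basis K _ lam

/-- Branching over two alphabets, F_λ(x, y) = ∑ F_{λ/μ}(x) F_μ(y), is the product of two matrices
through the intermediate μ. Even variables play the role of x and odd ones of y. -/
theorem pairing_comp_comulLin (d e : ℕ →₀ ℕ) :
    pairing (coeffGam d) (coeffGam e) ∘ₗ comulLin = coeffGam (interleave d e) := by
  refine basisF.ext fun lam => ?_
  let lam' : BddLen (lam.colLen 0) := ⟨lam, le_rfl⟩
  have h1 := coeff_skewF_eq lam' ⊥ (interleave d e)
  -- The factors are swapped so that the odd variables lead from the empty diagram to μ and the even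
  -- ones from μ to λ.
  rw [coe_bot_bddLen, monomialElt_interleave, mul_comm, map_mul,
    mul_apply_eq_sum_below _ _ ⊥ lam' (fun mu => MvPowerSeries.coeff e (F mu))
      (fun mu => MvPowerSeries.coeff d (skewF lam mu))
      (fun mu => by rw [← coeff_skewF_eq mu ⊥ e, coe_bot_bddLen]; rfl)
      (fun mu => (coeff_skewF_eq lam' mu d).symm)] at h1
  rw [LinearMap.comp_apply, comulLin_basisF, map_sum, coeffGam_apply, coe_basisF, F, h1]
  refine Finset.sum_congr rfl fun mu _ => ?_
  rw [pairing_tmul, coeffGam_apply, coeffGam_apply, coe_basisF, mul_comm]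

theorem pairing_comulLin (d e : ℕ →₀ ℕ) (f : Gam) :
    pairing (coeffGam d) (coeffGam e) (comulLin f) = coeffGam (interleave d e) f :=
  LinearMap.congr_fun (pairing_comp_comulLin d e) f

theorem basisF_bot : basisF ⊥ = 1 := Subtype.ext <| (coe_basisF ⊥).trans F_bot

theorem comulLin_one : comulLin 1 = 1 := by
  have h : below ⊥ = {⊥} := by
    ext mu
    rw [mem_below, le_bot_iff, Finset.mem_singleton]
  rw [← basisF_bot, comulLin_basisF, h, Finset.sum_singleton, basisF_bot]
  have h1 : (⟨skewF ⊥ ⊥, skewF_mem_Gam ⊥ ⊥⟩ : Gam) = 1 := Subtype.ext F_bot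
  rw [h1]
  rfl

/-- Splitting the variables into two alphabets respects products of power series, so all coefficient
pairings of the two sides agree. -/
theorem comulLin_mul (f g : Gam) : comulLin (f * g) = comulLin f * comulLin g := by
  refine tensor_ext eq_zero_of_coeffGam eq_zero_of_coeffGam fun d e => ?_
  rw [pairing_comulLin, coeffGam_interleave_mul, pairing_mul]
  simp only [pairing_comulLin]

/-- The coproduct as a homomorphism of algebras. -/
def comulAlgHom : Gam →ₐ[K] Gam ⊗[K] Gam := AlgHom.ofLinearMap comulLin comulLin_one comulLin_mul

/-- The counit: the constant term. -/
def counitAlgHom : Gam →ₐ[K] K :=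
  AlgHom.ofLinearMap (coeffGam 0) (by rw [coeffGam_apply]; exact MvPowerSeries.coeff_zero_one)
    fun f g => by rw [coeffGam_mul, Finset.HasAntidiagonal.antidiagonal_zero, Finset.sum_singleton]

theorem counitAlgHom_basisF {lam : YoungDiagram} (h : lam ≠ ⊥) : counitAlgHom (basisF lam) = 0 := by
  change coeffGam 0 (basisF lam) = 0
  rw [coeffGam_apply, coe_basisF, F]
  refine coeff_skewF_eq_zero_of_degree_lt ?_
  rw [map_zero, add_zero]
  exact Finset.card_lt_card (YoungDiagram.cells_ssubset_iff.mpr (bot_lt_iff_ne_bot.mpr h))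

theorem monomialElt_interleave_zero_left (L : ℕ) (d : ℕ →₀ ℕ) :
    monomialElt L (interleave 0 d) = monomialElt L d := by
  rw [monomialElt_interleave, monomialElt, Finsupp.prod_zero_index, one_mul]

theorem monomialElt_interleave_zero_right (L : ℕ) (d : ℕ →₀ ℕ) :
    monomialElt L (interleave d 0) = monomialElt L d := by
  rw [monomialElt_interleave, mul_comm, ← monomialElt_interleave, monomialElt_interleave_zero_left]

theorem pairing_pairing_eq_zero (z : Gam ⊗[K] Gam)
    (h : ∀ de : (ℕ →₀ ℕ) × (ℕ →₀ ℕ), pairing (coeffGam de.1) (coeffGam de.2) z = 0) : z = 0 :=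
  tensor_ext eq_zero_of_coeffGam eq_zero_of_coeffGam fun d e => by rw [h (d, e), map_zero]

/-- Both sides read off coefficients in a union of three alphabets. The nested interleavings place
them differently, which symmetry makes irrelevant. -/
theorem coassoc_comulLin : (TensorProduct.assoc K Gam Gam Gam).toLinearMap ∘ₗ
    comulLin.rTensor Gam ∘ₗ comulLin = comulLin.lTensor Gam ∘ₗ comulLin := by
  refine LinearMap.ext fun f => tensor_ext eq_zero_of_coeffGam
    (g := fun de : (ℕ →₀ ℕ) × (ℕ →₀ ℕ) => pairing (coeffGam de.1) (coeffGam de.2))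
    pairing_pairing_eq_zero fun d de => ?_
  refine (pairing_assoc (coeffGam d) (coeffGam de.1) (coeffGam de.2) _).trans ?_
  rw [LinearMap.comp_apply, LinearMap.comp_apply, pairing_rTensor, pairing_lTensor,
    pairing_comp_comulLin, pairing_comp_comulLin, pairing_comulLin, pairing_comulLin]
  refine LinearMap.congr_fun (coeffGam_congr fun L => ?_) f
  simp only [monomialElt_interleave, mul_assoc]

theorem rTensor_counit_comulLin :
    (coeffGam 0).rTensor Gam ∘ₗ comulLin = TensorProduct.mk K K Gam 1 := by
  refine LinearMap.ext fun f => (TensorProduct.lid K Gam).injective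
    (sub_eq_zero.mp (eq_zero_of_coeffGam _ fun d => ?_))
  rw [map_sub, LinearMap.comp_apply, apply_lid_rTensor, pairing_comulLin, TensorProduct.mk_apply,
    TensorProduct.lid_tmul, one_smul, coeffGam_congr fun L => monomialElt_interleave_zero_left L d,
    sub_self]

theorem lTensor_counit_comulLin :
    (coeffGam 0).lTensor Gam ∘ₗ comulLin = (TensorProduct.mk K Gam K).flip 1 := by
  refine LinearMap.ext fun f => (TensorProduct.rid K Gam).injective
    (sub_eq_zero.mp (eq_zero_of_coeffGam _ fun d => ?_))
  rw [map_sub, LinearMap.comp_apply, apply_rid_lTensor, pairing_comulLin, LinearMap.flip_apply,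
    TensorProduct.mk_apply, TensorProduct.rid_tmul, one_smul,
    coeffGam_congr fun L => monomialElt_interleave_zero_right L d, sub_self]

theorem comm_comulLin : (TensorProduct.comm K Gam Gam).toLinearMap ∘ₗ comulLin = comulLin := by
  refine LinearMap.ext fun f => tensor_ext eq_zero_of_coeffGam eq_zero_of_coeffGam fun d e => ?_
  refine (pairing_comm (coeffGam d) (coeffGam e) _).trans ?_
  rw [pairing_comulLin, pairing_comulLin]
  refine LinearMap.congr_fun (coeffGam_congr fun L => ?_) f
  rw [monomialElt_interleave, monomialElt_interleave, mul_comm]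

instance coalgebraGam : Coalgebra K Gam where
  comul := comulLin
  counit := coeffGam 0
  coassoc := coassoc_comulLin
  rTensor_counit_comp_comul := rTensor_counit_comulLin
  lTensor_counit_comp_comul := lTensor_counit_comulLin

end InhomQWhittaker

end
-- The main theorem.
theorem theorem3p1 :
    -- (a) products expand finitely, and this is the only (possibly infinite) expansion
    (∀ mu nu : YoungDiagram, ∃ c : YoungDiagram →₀ InhomQWhittaker.K,
      InhomQWhittaker.F mu * InhomQWhittaker.F nu =
          c.sum (fun lam a => a • InhomQWhittaker.F lam) ∧
        ∀ c' : YoungDiagram → InhomQWhittaker.K,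
          InhomQWhittaker.IsExpansion (InhomQWhittaker.F mu * InhomQWhittaker.F nu) c' ↔
            c' = c) ∧
    -- (b) the functions form a basis of a subring of the completed ring of symmetric functions
    ∃ (Γ : Subalgebra InhomQWhittaker.K (MvPowerSeries ℕ InhomQWhittaker.K))
      (b : Module.Basis YoungDiagram InhomQWhittaker.K Γ),
      Γ ≤ InhomQWhittaker.LamHat ∧
      (∀ lam : YoungDiagram,
        (b lam : MvPowerSeries ℕ InhomQWhittaker.K) = InhomQWhittaker.F lam) ∧
      -- (c) the skew functions lie in this ring, and it is a cocommutative bialgebra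
      ∃ hskew : ∀ lam mu : YoungDiagram, InhomQWhittaker.skewF lam mu ∈ Γ,
      ∃ (_ : Coalgebra InhomQWhittaker.K Γ)
        (Δ : Γ →ₐ[InhomQWhittaker.K] Γ ⊗[InhomQWhittaker.K] Γ)
        (ε : Γ →ₐ[InhomQWhittaker.K] InhomQWhittaker.K),
        Δ.toLinearMap = Coalgebra.comul ∧
        ε.toLinearMap = Coalgebra.counit ∧
        Coalgebra.IsCocomm InhomQWhittaker.K Γ ∧
        (∀ lam : YoungDiagram,
          Δ (b lam) = ∑ mu ∈ InhomQWhittaker.below lam,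
            (⟨InhomQWhittaker.skewF lam mu, hskew lam mu⟩ : Γ) ⊗ₜ[InhomQWhittaker.K] b mu) ∧
        ε (b ⊥) = 1 ∧ ∀ lam : YoungDiagram, lam ≠ ⊥ → ε (b lam) = 0 := by
  refine ⟨fun mu nu => ?_, InhomQWhittaker.Gam, InhomQWhittaker.basisF,
    InhomQWhittaker.Gam_le_LamHat, InhomQWhittaker.coe_basisF, InhomQWhittaker.skewF_mem_Gam,
    InhomQWhittaker.coalgebraGam, InhomQWhittaker.comulAlgHom, InhomQWhittaker.counitAlgHom,
    rfl, rfl, ⟨InhomQWhittaker.comm_comulLin⟩, InhomQWhittaker.comulLin_basisF, ?_,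
    fun lam => InhomQWhittaker.counitAlgHom_basisF⟩
  · obtain ⟨c, hc⟩ := InhomQWhittaker.exists_F_mul_F_eq_sum mu nu
    refine ⟨c, hc, fun c' => ⟨fun h => ?_, ?_⟩⟩
    · rw [hc] at h
      exact h.unique (InhomQWhittaker.isExpansion_finsupp c)
    · rintro rfl
      rw [hc]
      exact InhomQWhittaker.isExpansion_finsupp c
  · rw [InhomQWhittaker.basisF_bot, map_one]
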